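/- Let $W$ be a finite alphabet. A $\mathbb{Z}^2$-subshift is a closed subset $X\subset W^{\mathbb{Z}^2}$ invariant under all shifts $(\sigma^a x)(b)=x(a+b)$, $a\in\mathbb{Z}^2$. An $(m,n)$-pattern is a map $p$ from an $m\times n$ rectangle ($m$ columns, $n$ rows) to $W$; it occurs in $X$ if it is the restriction of some $x\in X$. $X$ is called $d$-regular if it is of finite type and, for all $m,n\ge 1$, every $(m,n)$-pattern that occurs in $X$ has exactly $d$ extensions occurring in $X$ by one column to the right, exactly $d$ by one column to the left, exactly $d$ by one row upward and exactly $d$ by one row downward. A transition matrix is a square $\{0,1\}$-matrix without zero rows or columns. For transition matrices $A,B$ over a finite alphabet $S$, the matrix subshift $X(A,B)$ is the set of $x\in S^{\mathbb{Z}^2}$ with $A(x_{n,m},x_{n+1,m})=1$ and $B(x_{n,m},x_{n,m+1})=1$ for all $n,m$; it is extendable if every pair of admissible transitions along two adjacent edges of a $2\times 2$ square (in each of the four corners) can be completed to an admissible $2\times2$ pattern. The block representation of $X$ with respect to the $a\times b$ rectangle replaces $x\in X$ by the configuration whose symbol at $c\in\mathbb{Z}^2$ is the $a\times b$ pattern of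 $x$ with lower left corner $c$; its alphabet is the set of $a\times b$ patterns occurring in $X$. $X$ is called extendable if for some $a,b\geq 1$ its block representation with respect to the $a\times b$ rectangle is an extendable matrix subshift (for $a=b=1$: $X$ itself, over the symbols that occur in it, is an extendable matrix subshift). For $n\ge1$ let $H_n(X)$ be the directed graph whose vertices are the $(1,n)$-patterns occurring in $X$, with an edge $p_1\to p_2$ if placing $p_2$ to the right of $p_1$ gives a $(2,n)$-pattern occurring in $X$; $V_n(X)$ is defined in the same way with $(n,1)$-patterns and placing $p_2$ on top of $p_1$. For a finite $d$-regular directed graph $G$, let $\lambda(G)$ be the largest modulus of the eigenvalues of its adjacency matrix that remain when they are listed with algebraic multiplicity and one copy of the eigenvalue $d$ is removed ($\lambda(G)=0$ if none remains). $G$ is $r$-normal if its adjacency matrix is unitarily equivalent to a block-diagonal matrix with blocks of size at most $r\times r$. For $\lambda<1$ and $r\geq 1$, a family of $d$-regular directed graphs is a $(\lambda,r)$-expander family if every member $G$ is $r$-normal and satisfies $\lambda(G)/d\le\lambda$. **Theorem.** Let $X$ be a nonempty, $d$-regular and extendable $\mathbb{Z}^2$-subshift, and let $s$ be the number of symbols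 of $W$ that occur in $X$. Assume that the graphs $H_n(X)$, $V_n(X)$, $n\ge 1$, form a $(\lambda,r)$-expander family. Then: 1. There is a unique Borel probability measure $\mu$ on $X$ that gives mass $\frac{1}{s\,d^{m-1}d^{n-1}}$ to the cylinder set of every $(m,n)$-pattern ($m,n\ge1$) occurring in $X$, at every position in $\mathbb{Z}^2$. 2. $(X,\mathbb{Z}^2,\mu)$ is strongly mixing: for all $f,g\in L^2(X,\mu)$, $$\int_X (f\circ\sigma^n)\,g\,d\mu\;\longrightarrow\;\int_X f\,d\mu\int_X g\,d\mu\qquad\text{as }\|n\|_\infty\to\infty,\ n\in\mathbb{Z}^2.$$ 3. For any locally constant functions $f,g:X\to\mathbb{C}$ there is a constant $C>0$ such that for all $n\in\mathbb{Z}^2$, $$\left|\int_X (f\circ \sigma^n)\,g\,d\mu - \int_X f\,d\mu\int_X g\,d\mu\right|\leq C\,\max(1,\|n\|_\infty)^{r-1}\,\lambda^{\|n\|_\infty}.$$ -/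

import Mathlib

open MeasureTheory Filter Topology

noncomputable section

/-! ### Directed graphs: regularity, second eigenvalue, `r`-normality, expander families -/

/-- The adjacency matrix of a directed graph (loops allowed, no multiple edges), with complex
entries `0` and `1`. -/
def Digraph.adjMat {V : Type*} (G : Digraph V) : Matrix V V ℂ :=
  open Classical in fun i j => if G.Adj i j then 1 else 0

/-- A directed graph is `d`-regular if every vertex has exactly `d` outgoing and exactly `d`
incoming edges. -/
def Digraph.IsRegular {V : Type*} [Fintype V] (G : Digraph V) (d : ℕ) : Prop :=
  (∀ v, {w | G.Adj v w}.ncard = d) ∧ (∀ w, {v | G.Adj v w}.ncard = d)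

/-- For a `d`-regular directed graph `G`: the second-largest modulus of an eigenvalue. The
eigenvalues of the adjacency matrix are listed with algebraic multiplicity, one copy of the
Perron eigenvalue `d` is removed, and the largest modulus of the remaining ones is taken (it is
`0` if none remains). -/
def Digraph.secondEigenvalue {V : Type*} [Fintype V] (G : Digraph V) (d : ℕ) : ℝ :=
  open Classical in
  ((((G.adjMat.charpoly.roots).erase (d : ℂ)).map (fun z => ‖z‖₊)).sup : NNReal)

/-- A square matrix `A` is `r`-normal if it is unitarily equivalent to a block-diagonal matrix
with blocks of size at most `r × r`. The blocks are the fibres of the labelling `b`; they need not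
be intervals, since a permutation of the indices is itself a unitary equivalence. -/
def IsRNormal {V : Type*} [Fintype V] (A : Matrix V V ℂ) (r : ℕ) : Prop :=
  open Classical in
  ∃ U ∈ Matrix.unitaryGroup V ℂ, ∃ b : V → ℕ,
    (∀ k, {i | b i = k}.ncard ≤ r) ∧
    ∀ i j, b i ≠ b j → (star U * A * U) i j = 0

/-- `(G n)` for `n ≥ 1` is a `(lam, r)`-expander family of `d`-regular directed graphs. -/
def IsExpanderFamily {V : ℕ → Type*} [∀ n, Fintype (V n)] (G : ∀ n, Digraph (V n))
    (d : ℕ) (lam : ℝ) (r : ℕ) : Prop :=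
  lam < 1 ∧ ∀ n, 1 ≤ n →
    (G n).IsRegular d ∧ (G n).secondEigenvalue d / d ≤ lam ∧ IsRNormal (G n).adjMat r

/-! ### Two-dimensional subshifts -/

/-- The shift action of `ℤ²` on configurations: `(σ^a x)(b) = x(a + b)`. -/
def shiftConfig {W : Type*} (a : ℤ × ℤ) (x : ℤ × ℤ → W) : ℤ × ℤ → W := fun b => x (a + b)

/-- A `ℤ²`-subshift over the (finite, discrete) alphabet `W`: a closed, shift-invariant set of
configurations. -/
structure Subshift (W : Type*) [TopologicalSpace W] where
  carrier : Set (ℤ × ℤ → W)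
  isClosed' : IsClosed carrier
  shift_mem' : ∀ a : ℤ × ℤ, ∀ x ∈ carrier, shiftConfig a x ∈ carrier

/-- The pattern of shape `m × n` (`m` columns, `n` rows) which `x` shows in the rectangle with
lower left corner `c`. The first coordinate is horizontal, the second one vertical. -/
def window {W : Type*} (x : ℤ × ℤ → W) (c : ℤ × ℤ) (m n : ℕ) : Fin m × Fin n → W :=
  fun ij => x (c + (((ij.1 : ℕ) : ℤ), ((ij.2 : ℕ) : ℤ)))

/-! ### Matrix subshifts and extendability -/

/-- A transition matrix: entries in `{0,1}`, no zero rows or columns. -/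
def IsTransitionMatrix {S : Type*} (A : Matrix S S ℕ) : Prop :=
  (∀ i j, A i j = 0 ∨ A i j = 1) ∧ (∀ i, ∃ j, A i j ≠ 0) ∧ (∀ j, ∃ i, A i j ≠ 0)

/-- The matrix subshift `X(A,B)`: `A` governs horizontal and `B` vertical transitions. -/
def matrixSubshift {S : Type*} (A B : Matrix S S ℕ) : Set (ℤ × ℤ → S) :=
  {x | ∀ n m : ℤ, A (x (n, m)) (x (n + 1, m)) = 1 ∧ B (x (n, m)) (x (n, m + 1)) = 1}

/-- The matrix subshift of `A` and `B` is extendable: in a `2 × 2` square with bottom row `a b` and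
top row `c e`, every admissible pair of transitions along two adjacent edges (that is, every
admissible three-cell corner) can be completed to an admissible `2 × 2` pattern. -/
def IsExtendablePair {S : Type*} (A B : Matrix S S ℕ) : Prop :=
  (∀ a b c, A a b = 1 → B a c = 1 → ∃ e, A c e = 1 ∧ B b e = 1) ∧
  (∀ a b e, A a b = 1 → B b e = 1 → ∃ c, A c e = 1 ∧ B a c = 1) ∧
  (∀ b c e, A c e = 1 → B b e = 1 → ∃ a, A a b = 1 ∧ B a c = 1) ∧
  (∀ a c e, A c e = 1 → B a c = 1 → ∃ b, A a b = 1 ∧ B b e = 1)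

namespace Subshift

variable {W : Type*} [TopologicalSpace W]

/-- The action of `a ∈ ℤ²` on the points of the subshift. -/
def shift (X : Subshift W) (a : ℤ × ℤ) (x : X.carrier) : X.carrier :=
  ⟨shiftConfig a x.1, X.shift_mem' a x.1 x.2⟩

/-- `X` is of finite type: it is given by a finite shape `F` and a set `P` of allowed patterns
of shape `F`. -/
def IsFiniteType (X : Subshift W) : Prop :=
  ∃ (F : Finset (ℤ × ℤ)) (P : Set (F → W)),
    X.carrier = {x | ∀ a : ℤ × ℤ, (fun b : F => shiftConfig a x b) ∈ P}

/-- The rectangular pattern `p` occurs in `X`. -/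
def Occurs (X : Subshift W) {m n : ℕ} (p : Fin m × Fin n → W) : Prop :=
  ∃ x ∈ X.carrier, window x 0 m n = p

/-- The patterns of shape `m × n` that occur in `X`. -/
def Pattern (X : Subshift W) (m n : ℕ) : Type _ := {p : Fin m × Fin n → W // X.Occurs p}

instance (X : Subshift W) (m n : ℕ) [Finite W] : Finite (X.Pattern m n) :=
  inferInstanceAs (Finite {p : Fin m × Fin n → W // X.Occurs p})

instance (X : Subshift W) (m n : ℕ) [Finite W] : Fintype (X.Pattern m n) :=
  Fintype.ofFinite _

/-- `X` is `d`-regular: it is of finite type, and every (nonempty) rectangular pattern that occurs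
in `X` has exactly `d` extensions occurring in `X` by one column to the right, by one column to the
left, by one row upward, and by one row downward. -/
def IsRegular (X : Subshift W) (d : ℕ) : Prop :=
  X.IsFiniteType ∧
  ∀ m n : ℕ, 1 ≤ m → 1 ≤ n → ∀ p : Fin m × Fin n → W, X.Occurs p →
    {q : Fin (m + 1) × Fin n → W | X.Occurs q ∧ ∀ i j, q (i.castSucc, j) = p (i, j)}.ncard = d ∧
    {q : Fin (m + 1) × Fin n → W | X.Occurs q ∧ ∀ i j, q (i.succ, j) = p (i, j)}.ncard = d ∧
    {q : Fin m × Fin (n + 1) → W | X.Occurs q ∧ ∀ i j, q (i, j.castSucc) = p (i, j)}.ncard = d ∧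
    {q : Fin m × Fin (n + 1) → W | X.Occurs q ∧ ∀ i j, q (i, j.succ) = p (i, j)}.ncard = d

/-- The horizontal transition graph `H_n(X)`: vertices are the patterns of shape `(1,n)` occurring
in `X`; there is an edge `p₁ → p₂` if placing `p₂` to the right of `p₁` gives a pattern of shape
`(2,n)` occurring in `X`. -/
def horizontalGraph (X : Subshift W) (n : ℕ) : Digraph (X.Pattern 1 n) where
  Adj p₁ p₂ := X.Occurs
    (fun ij : Fin 2 × Fin n => if ij.1 = 0 then p₁.1 (0, ij.2) else p₂.1 (0, ij.2))

/-- The vertical transition graph `V_n(X)`: vertices are the patterns of shape `(n,1)` occurring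
in `X`; there is an edge `p₁ → p₂` if placing `p₂` on top of `p₁` gives a pattern of shape
`(n,2)` occurring in `X`. -/
def verticalGraph (X : Subshift W) (n : ℕ) : Digraph (X.Pattern n 1) where
  Adj p₁ p₂ := X.Occurs
    (fun ij : Fin n × Fin 2 => if ij.2 = 0 then p₁.1 (ij.1, 0) else p₂.1 (ij.1, 0))

/-- The block representation of `X` with respect to the `a × b` rectangle, as a set of
configurations over the alphabet of those `a × b` patterns that occur in `X`. -/
def blockRep (X : Subshift W) (a b : ℕ) : Set (ℤ × ℤ → X.Pattern a b) :=
  {y | ∃ x ∈ X.carrier, ∀ c : ℤ × ℤ, (y c).1 = window x c a b}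

/-- `X` is extendable: it is, in some rectangular block representation, an extendable matrix
subshift. For `a = b = 1` the block representation is `X` itself, over the symbols that occur
in `X`. -/
def IsExtendable (X : Subshift W) : Prop :=
  ∃ a b : ℕ, 1 ≤ a ∧ 1 ≤ b ∧ ∃ A B : Matrix (X.Pattern a b) (X.Pattern a b) ℕ,
    IsTransitionMatrix A ∧ IsTransitionMatrix B ∧ IsExtendablePair A B ∧
    X.blockRep a b = matrixSubshift A B

variable [MeasurableSpace W]

/-- `μ` is the natural uniform measure of the `d`-regular subshift `X`: a probability measure that
gives mass `1 / (s d^(m-1) d^(n-1))` to every cylinder set supported on a translate of the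
`m × n` rectangle, where `s` is the number of symbols that occur in `X`. -/
structure IsNaturalMeasure (X : Subshift W) (d : ℕ) (μ : Measure X.carrier) : Prop where
  isProbabilityMeasure : IsProbabilityMeasure μ
  cylinder : ∀ m n : ℕ, 1 ≤ m → 1 ≤ n → ∀ (c : ℤ × ℤ) (p : Fin m × Fin n → W), X.Occurs p →
    μ {x | window x.1 c m n = p} =
      (((Nat.card (X.Pattern 1 1) * d ^ (m - 1) * d ^ (n - 1) : ℕ) : ENNReal))⁻¹

end Subshift

/-- The norm `‖n‖_∞` of `n ∈ ℤ²`. -/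
def supNorm (n : ℤ × ℤ) : ℕ := max n.1.natAbs n.2.natAbs

/-- `(X, ℤ², μ)` is strongly mixing: for all `f, g ∈ L²(X, μ)`,
`∫ (f ∘ σ^n) g dμ → ∫ f dμ ∫ g dμ` as `‖n‖_∞ → ∞`. -/
def Subshift.IsStronglyMixing {W : Type*} [TopologicalSpace W] [MeasurableSpace W]
    (X : Subshift W) (μ : Measure X.carrier) : Prop :=
  ∀ f g : X.carrier → ℂ, MemLp f 2 μ → MemLp g 2 μ →
    Tendsto (fun n : ℤ × ℤ => ∫ x, f (X.shift n x) * g x ∂μ) (comap supNorm atTop)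
      (𝓝 ((∫ x, f x ∂μ) * ∫ x, g x ∂μ))

end

/-!
The natural measure `μ` makes the columns of height `N` seen along a horizontal strip a stationary
Markov chain: a uniform random walk on the graph `H_N(X)`. Likewise the rows of length `N` along a
vertical strip form a uniform random walk on `V_N(X)`
(`Subshift.IsNaturalMeasure.isUniformWalk_columnAt` and its companion for rows). No extendability
is needed for this: an admissible word splits its mass among at most `d` continuations, each of
which receives at most a `d`-th part, so each of the `d` out-neighbours receives exactly a `d`-th
part (`Digraph.IsUniformWalk.real_word_snoc`).

The transition matrix `P` of such a walk is the adjacency matrix divided by `d`. It is doubly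
stochastic, so it is a contraction of `ℓ²`, and as `λ < 1` its eigenvalue `1` is simple. A unitary
block decomposition with blocks of size at most `r` therefore induces a decomposition of the
orthogonal complement of the constants into orthogonal invariant subspaces of dimension at most
`r`, on which all eigenvalues have modulus at most `λ`. By Cayley-Hamilton, a vector of such a
subspace is killed by a product of at most `r` factors `P - z` with `|z| ≤ λ`, and an induction on
the number of factors gives `‖P ^ L v‖ ≤ 2 ^ r max(1, L) ^ (r - 1) λ ^ (L - (r - 1)) ‖v‖`
(`Digraph.sum_sq_norm_walkMat_pow_mulVec_le`). This bound does not depend on the graph. For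
functions of two `K × K` windows at distance `‖n‖_∞`, the shorter component of `n` only enters the
height `N` of the strip containing both windows, so the bound yields the decay of correlations, with
a constant that contains a power of `1 / λ` depending on `K` and `r`.

The case `λ = 0` is therefore separate: the walk on `H_N(X)` equidistributes after
`r + 1` steps, so `H_N(X)` has at most `d ^ (r + 1)` vertices for every `N`; hence `d = 1` and `X`
is a single point (`Subshift.subsingleton_of_isExpanderFamily_zero`).

The measure `μ` exists because each pattern has the same number of extensions to a larger
rectangle: uniform measures on representatives of the patterns of growing squares have a limit
point with the prescribed masses. It is unique since the cylinders over central squares form a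
generating `π`-system. Strong mixing follows from the decay of correlations because locally constant
functions are dense in `L²`.
-/

noncomputable section

/-! ### Powers of a contraction on an invariant subspace of bounded dimension -/

open Polynomial in
/-- Powers of a contraction on a vector killed by a product of factors `X - z` with `|z| ≤ lam`.
The truncated exponent of `lam` keeps the bound meaningful for `lam = 0`. -/
theorem norm_pow_apply_le_of_aeval_prod_eq_zero {E : Type*} [NormedAddCommGroup E]
    [NormedSpace ℂ E] (T : Module.End ℂ E) (hT : ∀ v, ‖T v‖ ≤ ‖v‖) {lam : ℝ}
    (h0 : 0 ≤ lam) (h1 : lam ≤ 1) (s : Multiset ℂ) (hs : ∀ z ∈ s, ‖z‖ ≤ lam) (v : E)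
    (hv : aeval T (s.map fun z => X - C z).prod v = 0) (L : ℕ) :
    ‖(T ^ L) v‖ ≤ (2 ^ s.card - 1) * max 1 (L : ℝ) ^ (s.card - 1) *
      lam ^ (L - (s.card - 1)) * ‖v‖ := by
  induction s using Multiset.induction_on generalizing v L with
  | empty =>
    have : v = 0 := by simpa using hv
    simp [this]
  | cons z t ih =>
    have hz : ‖z‖ ≤ lam := hs z (Multiset.mem_cons_self z t)
    set j := t.card with hj
    set w := T v - z • v with hw
    have hw0 : aeval T (t.map fun z => X - C z).prod w = 0 := by
      rw [Multiset.map_cons, Multiset.prod_cons, mul_comm, map_mul] at hv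
      rw [hw]
      simpa [Module.algebraMap_end_apply] using hv
    have hwn : ‖w‖ ≤ 2 * ‖v‖ := by
      calc ‖w‖ ≤ ‖T v‖ + ‖z • v‖ := norm_sub_le _ _
        _ ≤ ‖v‖ + 1 * ‖v‖ := by
          rw [norm_smul]
          exact add_le_add (hT v) (by gcongr; exact hz.trans h1)
        _ = 2 * ‖v‖ := by ring
    have hc : (0 : ℝ) ≤ 2 ^ j - 1 := by
      have : (1 : ℝ) ≤ 2 ^ j := one_le_pow₀ (by norm_num)
      linarith
    have hwL : ∀ L : ℕ, ‖(T ^ L) w‖ ≤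
        (2 ^ j - 1) * max 1 (L : ℝ) ^ (j - 1) * lam ^ (L - (j - 1)) * (2 * ‖v‖) := fun L =>
      (ih (fun z hz => hs z (Multiset.mem_cons_of_mem hz)) w hw0 L).trans
        (mul_le_mul_of_nonneg_left hwn (by positivity))
    -- Unrolling `T ^ (L + 1) v = z • T ^ L v + T ^ L w` costs one factor `L`.
    have key : ∀ L : ℕ, ‖(T ^ L) v‖ ≤ (lam ^ L +
        L * ((2 * (2 ^ j - 1)) * max 1 (L : ℝ) ^ (j - 1) * lam ^ (L - j))) * ‖v‖ := by
      intro L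
      induction L with
      | zero => simp
      | succ L ihL =>
        have hstep : (T ^ (L + 1)) v = z • (T ^ L) v + (T ^ L) w := by
          rw [hw, pow_succ, Module.End.mul_apply, map_sub, map_smul]; abel
        have e1 : lam * lam ^ (L - j) ≤ lam ^ (L + 1 - j) := by
          rw [← pow_succ']; exact pow_le_pow_of_le_one h0 h1 (by omega)
        have e2 : (2 ^ j - 1) * lam ^ (L - (j - 1)) ≤ (2 ^ j - 1) * lam ^ (L + 1 - j) := by
          rcases Nat.eq_zero_or_pos j with h | h
          · simp [h]
          · exact mul_le_mul_of_nonneg_left (pow_le_pow_of_le_one h0 h1 (by omega)) hc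
        have e3 : max 1 (L : ℝ) ^ (j - 1) ≤ max 1 ((L + 1 : ℕ) : ℝ) ^ (j - 1) := by
          gcongr; simp
        set a := max 1 (L : ℝ) ^ (j - 1) with ha
        set b := max 1 ((L + 1 : ℕ) : ℝ) ^ (j - 1) with hb
        have ha0 : 0 ≤ a := by positivity
        have hb0 : 0 ≤ b := by positivity
        set c : ℝ := 2 ^ j - 1 with hcdef
        calc ‖(T ^ (L + 1)) v‖ ≤ ‖z‖ * ‖(T ^ L) v‖ + ‖(T ^ L) w‖ := by
              rw [hstep, ← norm_smul]; exact norm_add_le _ _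
          _ ≤ lam * ((lam ^ L + L * ((2 * c) * a * lam ^ (L - j))) * ‖v‖) +
              c * a * lam ^ (L - (j - 1)) * (2 * ‖v‖) := by
              gcongr; exact hwL L
          _ = (lam ^ (L + 1) + (L * (2 * c * a * (lam * lam ^ (L - j))) +
                2 * a * (c * lam ^ (L - (j - 1))))) * ‖v‖ := by ring
          _ ≤ (lam ^ (L + 1) + (L * (2 * c * b * lam ^ (L + 1 - j)) +
                2 * b * (c * lam ^ (L + 1 - j)))) * ‖v‖ := by gcongr
          _ = _ := by push_cast; ring
    refine (key L).trans ?_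
    rw [Multiset.card_cons, ← hj, Nat.add_sub_cancel]
    gcongr
    have e1 : lam ^ L ≤ max 1 (L : ℝ) ^ j * lam ^ (L - j) :=
      (pow_le_pow_of_le_one h0 h1 (Nat.sub_le L j)).trans
        (le_mul_of_one_le_left (by positivity) (one_le_pow₀ (le_max_left _ _)))
    have e2 : L * ((2 * (2 ^ j - 1)) * max 1 (L : ℝ) ^ (j - 1) * lam ^ (L - j)) ≤
        (2 * (2 ^ j - 1)) * (max 1 (L : ℝ) ^ j * lam ^ (L - j)) := by
      rcases Nat.eq_zero_or_pos j with h | h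
      · simp [h]
      · obtain ⟨i, hi⟩ : ∃ i, j = i + 1 := ⟨j - 1, by omega⟩
        calc _ = (2 * (2 ^ j - 1)) * ((L : ℝ) * max 1 (L : ℝ) ^ (j - 1) * lam ^ (L - j)) := by ring
          _ ≤ (2 * (2 ^ j - 1)) * (max 1 (L : ℝ) * max 1 (L : ℝ) ^ (j - 1) * lam ^ (L - j)) := by
            gcongr; exact le_max_right _ _
          _ = _ := by rw [hi, Nat.add_sub_cancel]; ring
    calc _ ≤ max 1 (L : ℝ) ^ j * lam ^ (L - j) +
        (2 * (2 ^ j - 1)) * (max 1 (L : ℝ) ^ j * lam ^ (L - j)) := add_le_add e1 e2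
      _ = _ := by ring

/-- By Cayley-Hamilton, the characteristic polynomial of the restriction of `T` to `F` kills the
vectors of `F`; it has degree at most `r`, and its roots are eigenvalues of `T` with eigenvectors
in `F`. -/
theorem norm_pow_apply_le_of_mem_invariant {E : Type*} [NormedAddCommGroup E]
    [NormedSpace ℂ E] [FiniteDimensional ℂ E] (T : Module.End ℂ E) (hT : ∀ v, ‖T v‖ ≤ ‖v‖)
    {lam : ℝ} (h0 : 0 ≤ lam) (h1 : lam ≤ 1) (F : Submodule ℂ E) (hF : ∀ v ∈ F, T v ∈ F)
    {r : ℕ} (hr : Module.finrank ℂ F ≤ r)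
    (hev : ∀ z : ℂ, ∀ y ∈ F, y ≠ 0 → T y = z • y → ‖z‖ ≤ lam) {v : E} (hv : v ∈ F) (L : ℕ) :
    ‖(T ^ L) v‖ ≤ 2 ^ r * max 1 (L : ℝ) ^ (r - 1) * lam ^ (L - (r - 1)) * ‖v‖ := by
  set S : Module.End ℂ F := T.restrict hF with hS
  have hpow : ((S ^ L) ⟨v, hv⟩ : E) = (T ^ L) v := by
    rw [hS, Module.End.pow_restrict L hF]; rfl
  have hsplit := (IsAlgClosed.splits S.charpoly)
  have hcard : S.charpoly.roots.card = Module.finrank ℂ F := by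
    rw [← hsplit.natDegree_eq_card_roots, LinearMap.charpoly_natDegree]
  have hroots : ∀ z ∈ S.charpoly.roots, ‖z‖ ≤ lam := by
    intro z hz
    have hz' := (Module.End.hasEigenvalue_iff_isRoot_charpoly S z).2
      (Polynomial.isRoot_of_mem_roots hz)
    obtain ⟨y, hy⟩ := hz'.exists_hasEigenvector
    refine hev z y y.2 (by simpa using hy.2) ?_
    simpa [hS] using congrArg Subtype.val hy.apply_eq_smul
  have hann : Polynomial.aeval S (S.charpoly.roots.map fun z => Polynomial.X - Polynomial.C z).prod
      ⟨v, hv⟩ = 0 := by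
    rw [← hsplit.eq_prod_roots_of_monic S.charpoly_monic, LinearMap.aeval_self_charpoly]; rfl
  have := norm_pow_apply_le_of_aeval_prod_eq_zero S (fun w => hT w) h0 h1 _ hroots ⟨v, hv⟩ hann L
  rw [Submodule.norm_coe _ |>.symm, hpow, hcard] at this
  refine this.trans ?_
  have hone : (1 : ℝ) ≤ max 1 (L : ℝ) := le_max_left _ _
  have hn : ‖(⟨v, hv⟩ : F)‖ = ‖v‖ := rfl
  rw [hn]
  have e1 : lam ^ (L - (Module.finrank ℂ F - 1)) ≤ lam ^ (L - (r - 1)) :=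
    pow_le_pow_of_le_one h0 h1 (by omega)
  have e2 : (2 : ℝ) ^ Module.finrank ℂ F - 1 ≤ 2 ^ r :=
    (sub_le_self _ zero_le_one).trans (pow_le_pow_right₀ one_le_two hr)
  gcongr

/-- Bound for the powers of a contraction that commutes with a resolution of the identity into
orthogonal projections of rank at most `r`, when `1` is a simple eigenvalue and all others have
modulus at most `lam`. -/
theorem norm_pow_apply_le_of_projections {E : Type*} [NormedAddCommGroup E]
    [InnerProductSpace ℂ E] [FiniteDimensional ℂ E] (T : Module.End ℂ E)
    (hT : ∀ v, ‖T v‖ ≤ ‖v‖) {lam : ℝ} (h0 : 0 ≤ lam) (h1 : lam ≤ 1) {e : E} (he : T e = e)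
    (hperp : ∀ v, inner ℂ e v = 0 → inner ℂ e (T v) = 0)
    (hfix : ∀ y, T y = y → ∃ c : ℂ, y = c • e)
    (hev : ∀ z : ℂ, z ≠ 1 → ∀ y, y ≠ 0 → T y = z • y → ‖z‖ ≤ lam)
    {ι : Type*} (s : Finset ι) (Q : ι → Module.End ℂ E) (hsum : ∀ v, ∑ k ∈ s, Q k v = v)
    (hsymm : ∀ k, (Q k).IsSymmetric) (hidem : ∀ k v, Q k (Q k v) = Q k v)
    (hcomm : ∀ k v, Q k (T v) = T (Q k v)) {r : ℕ}
    (hrank : ∀ k, Module.finrank ℂ (LinearMap.range (Q k)) ≤ r)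
    {v : E} (hv : inner ℂ e v = 0) (L : ℕ) :
    ‖(T ^ L) v‖ ≤ 2 ^ r * max 1 (L : ℝ) ^ (r - 1) * lam ^ (L - (r - 1)) * ‖v‖ := by
  have hpyth : ∀ w : E, ‖w‖ ^ 2 = ∑ k ∈ s, ‖Q k w‖ ^ 2 := by
    intro w
    have h : ∀ k, inner ℂ (Q k w) w = ((‖Q k w‖ ^ 2 : ℝ) : ℂ) := fun k => by
      rw [← hidem, hsymm, inner_self_eq_norm_sq_to_K, hidem]; norm_cast
    have h2 : ((‖w‖ ^ 2 : ℝ) : ℂ) = ((∑ k ∈ s, ‖Q k w‖ ^ 2 : ℝ) : ℂ) := by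
      rw [Complex.ofReal_sum]
      simp_rw [← h]
      rw [← sum_inner, hsum, inner_self_eq_norm_sq_to_K]; norm_cast
    exact_mod_cast h2
  have hcommL : ∀ k w, Q k ((T ^ L) w) = (T ^ L) (Q k w) := by
    intro k w
    induction L generalizing w with
    | zero => simp
    | succ L ih => rw [pow_succ, Module.End.mul_apply, ih, hcomm]; rfl
  -- A fixed vector of `T` is a multiple of `e`, so each `Q k e` is, and `Q k` preserves `e^⊥`.
  have hQperp : ∀ k w, inner ℂ e w = 0 → inner ℂ e (Q k w) = 0 := by
    intro k w hw
    obtain ⟨c, hc⟩ := hfix (Q k e) (by rw [← hcomm, he])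
    rw [← hsymm, hc, inner_smul_left, hw, mul_zero]
  set C : ℝ := 2 ^ r * max 1 (L : ℝ) ^ (r - 1) * lam ^ (L - (r - 1)) with hC
  have hC0 : 0 ≤ C := by positivity
  have hblock : ∀ k, ‖(T ^ L) (Q k v)‖ ≤ C * ‖Q k v‖ := by
    intro k
    refine norm_pow_apply_le_of_mem_invariant T hT h0 h1
      (LinearMap.range (Q k) ⊓ LinearMap.ker (innerSL ℂ e).toLinearMap) ?_
      ((Submodule.finrank_mono inf_le_left).trans (hrank k)) ?_ ?_ L
    · rintro w ⟨⟨u, rfl⟩, hw⟩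
      exact ⟨⟨T u, hcomm k u⟩, hperp _ hw⟩
    · rintro z y ⟨-, hy⟩ hy0 hTy
      refine hev z ?_ y hy0 hTy
      rintro rfl
      obtain ⟨c, rfl⟩ := hfix y (by rw [hTy, one_smul])
      have hy' : inner ℂ e (c • e) = 0 := hy
      rw [inner_smul_right, mul_eq_zero, inner_self_eq_zero] at hy'
      rcases hy' with h | h <;> simp [h] at hy0
    · exact ⟨⟨v, rfl⟩, hQperp k v hv⟩
  refine (sq_le_sq₀ (norm_nonneg _) (by positivity)).1 ?_
  rw [hpyth, mul_pow, hpyth v, Finset.mul_sum]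
  refine Finset.sum_le_sum fun k _ => ?_
  rw [hcommL, ← mul_pow]
  exact pow_le_pow_left₀ (norm_nonneg _) (hblock k) 2

/-! ### The walk matrix of a regular graph -/

namespace Digraph

variable {V : Type*} [Fintype V] {G : Digraph V} {d : ℕ}

/-- The transition matrix of the uniform random walk on a `d`-regular directed graph. -/
def walkMat (G : Digraph V) (d : ℕ) : Matrix V V ℂ := (d : ℂ)⁻¹ • G.adjMat

theorem sum_adjMat_row (h : G.IsRegular d) (i : V) : ∑ j, G.adjMat i j = d := by
  classical
  rw [← h.1 i, Set.ncard_eq_toFinset_card']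
  simp [adjMat]

theorem sum_adjMat_col (h : G.IsRegular d) (j : V) : ∑ i, G.adjMat i j = d := by
  classical
  rw [← h.2 j, Set.ncard_eq_toFinset_card']
  simp [adjMat]

theorem sum_walkMat_row (h : G.IsRegular d) (hd : d ≠ 0) (i : V) : ∑ j, G.walkMat d i j = 1 := by
  simp only [walkMat, Matrix.smul_apply, smul_eq_mul, ← Finset.mul_sum, sum_adjMat_row h]
  exact inv_mul_cancel₀ (by exact_mod_cast hd)

theorem sum_walkMat_col (h : G.IsRegular d) (hd : d ≠ 0) (j : V) : ∑ i, G.walkMat d i j = 1 := by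
  simp only [walkMat, Matrix.smul_apply, smul_eq_mul, ← Finset.mul_sum, sum_adjMat_col h]
  exact inv_mul_cancel₀ (by exact_mod_cast hd)

theorem walkMat_eq_norm {V : Type*} (G : Digraph V) (d : ℕ) (i j : V) :
    G.walkMat d i j = (‖G.walkMat d i j‖ : ℂ) := by
  classical
  simp only [walkMat, Matrix.smul_apply, adjMat]
  split_ifs <;> simp

/-- A doubly stochastic matrix is a contraction of `ℓ²`, by Jensen's inequality. -/
theorem sum_sq_norm_walkMat_mulVec_le (h : G.IsRegular d) (hd : d ≠ 0) (f : V → ℂ) :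
    ∑ i, ‖(G.walkMat d).mulVec f i‖ ^ 2 ≤ ∑ i, ‖f i‖ ^ 2 := by
  have hrow : ∀ i, ∑ j, ‖G.walkMat d i j‖ = 1 := fun i => by
    have := sum_walkMat_row h hd i
    rw [Finset.sum_congr rfl fun j _ => walkMat_eq_norm G d i j, ← Complex.ofReal_sum] at this
    exact_mod_cast this
  have hcol : ∀ j, ∑ i, ‖G.walkMat d i j‖ = 1 := fun j => by
    have := sum_walkMat_col h hd j
    rw [Finset.sum_congr rfl fun i _ => walkMat_eq_norm G d i j, ← Complex.ofReal_sum] at this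
    exact_mod_cast this
  calc ∑ i, ‖(G.walkMat d).mulVec f i‖ ^ 2
      ≤ ∑ i, ∑ j, ‖G.walkMat d i j‖ * ‖f j‖ ^ 2 := by
        refine Finset.sum_le_sum fun i _ => ?_
        refine le_trans ?_ (Real.pow_arith_mean_le_arith_mean_pow Finset.univ
          (fun j => ‖G.walkMat d i j‖) (fun j => ‖f j‖) (fun _ _ => norm_nonneg _) (hrow i)
          (fun _ _ => norm_nonneg _) 2)
        gcongr
        refine (norm_sum_le _ _).trans (le_of_eq ?_)
        simp
    _ = ∑ j, ‖f j‖ ^ 2 := by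
        rw [Finset.sum_comm]
        simp_rw [← Finset.sum_mul, hcol, one_mul]

open Classical in
theorem mem_roots_of_adjMat_mulVec {z : ℂ} {y : V → ℂ} (hy : y ≠ 0)
    (h : G.adjMat.mulVec y = z • y) : z ∈ G.adjMat.charpoly.roots := by
  rw [Polynomial.mem_roots (Matrix.charpoly_monic _).ne_zero, ← Matrix.charpoly_toLin',
    ← Module.End.hasEigenvalue_iff_isRoot_charpoly]
  exact Module.End.hasEigenvalue_of_hasEigenvector
    (Module.End.hasEigenvector_iff.2 ⟨Module.End.mem_eigenspace_iff.2 h, hy⟩)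

open Classical in
theorem norm_le_secondEigenvalue {z : ℂ} (hz : z ∈ G.adjMat.charpoly.roots.erase (d : ℂ)) :
    ‖z‖ ≤ G.secondEigenvalue d := by
  have := Multiset.le_sup (Multiset.mem_map_of_mem (fun z : ℂ => ‖z‖₊) hz)
  exact_mod_cast this

theorem secondEigenvalue_nonneg : 0 ≤ G.secondEigenvalue d := NNReal.coe_nonneg _

/-- If the second eigenvalue is less than `d`, then the eigenvalue `d` is simple. -/
theorem exists_eq_const_of_adjMat_mulVec (h : G.IsRegular d) (hlt : G.secondEigenvalue d < d)
    [Nonempty V] {y : V → ℂ} (hy : G.adjMat.mulVec y = (d : ℂ) • y) :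
    ∃ c : ℂ, y = fun _ => c := by
  classical
  have hcount : G.adjMat.charpoly.roots.count (d : ℂ) ≤ 1 := by
    by_contra hcon
    have hmem : (d : ℂ) ∈ G.adjMat.charpoly.roots.erase (d : ℂ) := by
      rw [← Multiset.one_le_count_iff_mem, Multiset.count_erase_self]; omega
    have := norm_le_secondEigenvalue hmem
    rw [Complex.norm_natCast] at this
    exact absurd this (not_le.2 hlt)
  set Z := Module.End.eigenspace (Matrix.toLin' G.adjMat) (d : ℂ) with hZ
  have hfr : Module.finrank ℂ Z ≤ 1 := by
    refine (LinearMap.finrank_eigenspace_le _ _).trans ?_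
    rwa [Matrix.charpoly_toLin', ← Polynomial.count_roots]
  have hone : (fun _ => 1 : V → ℂ) ∈ Z := by
    rw [hZ, Module.End.mem_eigenspace_iff]
    ext i
    simpa [Matrix.mulVec, dotProduct] using sum_adjMat_row h i
  have hyZ : y ∈ Z := Module.End.mem_eigenspace_iff.2 hy
  obtain ⟨u, hu⟩ := finrank_le_one_iff.1 hfr
  obtain ⟨a, ha⟩ := hu ⟨_, hone⟩
  obtain ⟨b, hb⟩ := hu ⟨_, hyZ⟩
  have ha' : ∀ i, a * u.1 i = 1 := fun i => congrFun (congrArg Subtype.val ha) i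
  have hb' : ∀ i, b * u.1 i = y i := fun i => congrFun (congrArg Subtype.val hb) i
  refine ⟨b / a, funext fun i => ?_⟩
  have ha0 : a ≠ 0 := fun h => by simpa [h] using ha' i
  rw [← hb', eq_div_iff ha0, mul_assoc, mul_comm _ a, ha', mul_one]

/-- The bound for the powers of the walk matrix on functions of mean zero, uniform over all
`r`-normal graphs with second eigenvalue at most `lam * d`. -/
theorem sum_sq_norm_walkMat_pow_mulVec_le [Nonempty V] (h : G.IsRegular d) (hd : d ≠ 0)
    {lam : ℝ} (hlam : lam < 1) (hsec : G.secondEigenvalue d / d ≤ lam) {r : ℕ}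
    (hr : IsRNormal G.adjMat r) {f : V → ℂ} (hf : ∑ v, f v = 0) (L : ℕ) :
    ∑ v, ‖((open Classical in G.walkMat d ^ L).mulVec f) v‖ ^ 2 ≤
      (2 ^ r * max 1 (L : ℝ) ^ (r - 1) * lam ^ (L - (r - 1))) ^ 2 * ∑ v, ‖f v‖ ^ 2 := by
  classical
  have hd0 : (d : ℂ) ≠ 0 := by exact_mod_cast hd
  have hdpos : (0 : ℝ) < d := by exact_mod_cast Nat.pos_of_ne_zero hd
  have h0 : 0 ≤ lam := (div_nonneg secondEigenvalue_nonneg hdpos.le).trans hsec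
  have hsec' : G.secondEigenvalue d ≤ lam * d := (div_le_iff₀ hdpos).1 hsec
  have hlt : G.secondEigenvalue d < d := hsec'.trans_lt (by nlinarith)
  obtain ⟨U, hU, b, hb, hblock⟩ := hr
  have hUU : U * star U = 1 := Matrix.mem_unitaryGroup_iff.1 hU
  have hUU' : star U * U = 1 := Matrix.mem_unitaryGroup_iff'.1 hU
  set τ := Matrix.toEuclideanCLM (n := V) (𝕜 := ℂ) with hτ
  have hτa : ∀ (M : Matrix V V ℂ) (w : EuclideanSpace ℂ V) i, (τ M w) i = M.mulVec w.ofLp i :=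
    fun M w i => by
      rw [hτ, Matrix.ofLp_toEuclideanCLM]
  set P := G.walkMat d with hP
  let T : Module.End ℂ (EuclideanSpace ℂ V) := (τ P).toLinearMap
  have hTpow : ∀ w, (T ^ L) w = τ (P ^ L) w := fun w => by
    rw [map_pow, ← ContinuousLinearMap.coe_coe, ContinuousLinearMap.toLinearMap_pow]
  let e : EuclideanSpace ℂ V := WithLp.toLp 2 fun _ => 1
  have hinner : ∀ w : EuclideanSpace ℂ V, inner ℂ e w = ∑ i, w i := fun w => by
    simp [e, PiLp.inner_apply]
  have hPA : ∀ (y : V → ℂ) (z : ℂ), P.mulVec y = z • y → G.adjMat.mulVec y = (d * z) • y := by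
    intro y z hy
    rw [mul_smul, ← hy, hP, walkMat, Matrix.smul_mulVec, smul_smul, mul_inv_cancel₀ hd0, one_smul]
  let D : ℕ → Matrix V V ℂ := fun k => Matrix.diagonal fun i => if b i = k then 1 else 0
  let R : ℕ → Matrix V V ℂ := fun k => U * D k * star U
  have hDD : ∀ k, D k * D k = D k := fun k => by
    simp only [D, Matrix.diagonal_mul_diagonal]
    congr 1; ext i; split_ifs <;> simp
  have hDstar : ∀ k, star (D k) = D k := fun k => by
    simp only [D, Matrix.star_eq_conjTranspose, Matrix.diagonal_conjTranspose]
    congr 1; ext i; simp only [Pi.star_apply]; split_ifs <;> simp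
  have hDcomm : ∀ k, D k * (star U * G.adjMat * U) = (star U * G.adjMat * U) * D k := fun k => by
    ext i j
    rw [Matrix.diagonal_mul, Matrix.mul_diagonal]
    by_cases hij : b i = b j
    · rw [hij, mul_comm]
    · rw [hblock i j hij, mul_zero, zero_mul]
  have hRcomm : ∀ k, R k * P = P * R k := fun k => by
    have : R k * G.adjMat = G.adjMat * R k := by
      calc R k * G.adjMat = U * (D k * (star U * G.adjMat * U)) * star U := by
            simp only [R, mul_assoc, hUU, mul_one]
        _ = (U * star U) * G.adjMat * (U * D k * star U) := by
            rw [hDcomm]; simp only [mul_assoc]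
        _ = _ := by rw [hUU, one_mul]
    rw [hP, walkMat, Matrix.mul_smul, Matrix.smul_mul, this]
  have hRR : ∀ k, R k * R k = R k := fun k => by
    calc R k * R k = U * D k * (star U * U) * D k * star U := by simp only [R, mul_assoc]
      _ = U * (D k * D k) * star U := by rw [hUU', mul_one, mul_assoc U]
      _ = R k := by rw [hDD]
  have hRstar : ∀ k, star (R k) = R k := fun k => by
    simp only [R, star_mul, star_star, hDstar, mul_assoc]
  have hRsum : ∑ k ∈ Finset.univ.image b, R k = 1 := by
    have : ∑ k ∈ Finset.univ.image b, D k = 1 := by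
      ext i j
      rw [Matrix.sum_apply]
      by_cases hij : i = j
      · subst hij
        simp [D]
      · simp [D, hij]
    simp only [R]
    rw [← Finset.sum_mul, ← Finset.mul_sum, this, mul_one, hUU]
  let Q : ℕ → Module.End ℂ (EuclideanSpace ℂ V) := fun k => (τ (R k)).toLinearMap
  have hmulapp : ∀ (M N : Matrix V V ℂ) w, τ M (τ N w) = τ (M * N) w := fun M N w => by
    rw [map_mul]; rfl
  have key := norm_pow_apply_le_of_projections T ?_ h0 hlam.le (e := e) ?_ ?_ ?_ ?_
    (Finset.univ.image b) Q ?_ ?_ ?_ ?_ (r := r) ?_ (v := WithLp.toLp 2 f) ?_ L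
  · rw [hTpow] at key
    have := pow_le_pow_left₀ (norm_nonneg _) key 2
    rw [mul_pow, EuclideanSpace.norm_sq_eq, EuclideanSpace.norm_sq_eq] at this
    simpa only [hτa] using this
  · intro w
    refine (sq_le_sq₀ (norm_nonneg _) (norm_nonneg _)).1 ?_
    rw [EuclideanSpace.norm_sq_eq, EuclideanSpace.norm_sq_eq]
    simpa only [T, ContinuousLinearMap.coe_coe, hτa] using sum_sq_norm_walkMat_mulVec_le h hd w.ofLp
  · ext i
    simp only [T, ContinuousLinearMap.coe_coe, hτa]
    simpa [e, Matrix.mulVec, dotProduct] using sum_walkMat_row h hd i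
  · intro w hw
    rw [hinner] at hw ⊢
    simp only [T, ContinuousLinearMap.coe_coe, hτa, Matrix.mulVec, dotProduct]
    rw [Finset.sum_comm]
    simp_rw [← Finset.sum_mul, hP, sum_walkMat_col h hd, one_mul]
    exact hw
  · intro y hy
    obtain ⟨c, hc⟩ := exists_eq_const_of_adjMat_mulVec h hlt (y := y.ofLp) (by
      have := hPA y.ofLp 1 (by
        ext i; rw [← hτa, one_smul]; exact congrArg (fun w : EuclideanSpace ℂ V => w i) hy)
      rwa [mul_one] at this)
    refine ⟨c, ?_⟩
    ext i
    simpa [e] using congrFun hc i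
  · intro z hz y hy hTy
    have hroot := mem_roots_of_adjMat_mulVec (G := G) (y := y.ofLp) (z := d * z)
      (by simpa using hy) (hPA y.ofLp z (by
        ext i; rw [← hτa]; exact congrArg (fun w : EuclideanSpace ℂ V => w i) hTy))
    have hne : (d : ℂ) * z ≠ d := fun hcon => hz (by
      have : (d : ℂ) * z = d * 1 := by rw [hcon, mul_one]
      exact mul_left_cancel₀ hd0 this)
    have := norm_le_secondEigenvalue ((Multiset.mem_erase_of_ne hne).2 hroot)
    rw [norm_mul, Complex.norm_natCast] at this
    nlinarith
  · intro w
    have : ∑ k ∈ Finset.univ.image b, τ (R k) = 1 := by rw [← map_sum, hRsum, map_one]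
    have h2 := congrArg (fun S => S w) this
    simpa [Q, sum_apply] using h2
  · intro k x y
    change inner ℂ (τ (R k) x) y = inner ℂ x (τ (R k) y)
    rw [← ContinuousLinearMap.adjoint_inner_right, ← ContinuousLinearMap.star_eq_adjoint,
      ← map_star, hRstar]
  · intro k w
    change τ (R k) (τ (R k) w) = τ (R k) w
    rw [hmulapp, hRR]
  · intro k w
    change τ (R k) (τ P w) = τ P (τ (R k) w)
    rw [hmulapp, hmulapp, hRcomm]
  · intro k
    have h1 : Module.finrank ℂ (LinearMap.range (Q k)) = (R k).rank := by
      rw [Matrix.rank_eq_finrank_range_toLin (R k) (EuclideanSpace.basisFun V ℂ).toBasis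
        (EuclideanSpace.basisFun V ℂ).toBasis]
      rfl
    rw [h1]
    refine (Matrix.rank_mul_le_left _ _).trans ((Matrix.rank_mul_le_right _ _).trans ?_)
    rw [Matrix.rank_diagonal]
    refine le_trans (le_of_eq ?_) (hb k)
    rw [Set.ncard_eq_toFinset_card', Fintype.card_subtype]
    congr 1; ext i; simp
  · rw [hinner]; exact hf

end Digraph

/-- With `λ = 0` the random walk equidistributes exactly after `r + 1` steps, so every vertex is
reached by one of the `d ^ (r + 1)` paths of that length. -/
theorem Digraph.card_le_of_secondEigenvalue_le_zero {V : Type*} [Fintype V] {G : Digraph V} {d : ℕ}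
    [Nonempty V] (hG : G.IsRegular d) (hd : d ≠ 0) (hsec : G.secondEigenvalue d / d ≤ 0) {r : ℕ}
    (hr : IsRNormal G.adjMat r) : Fintype.card V ≤ d ^ (r + 1) := by
  classical
  obtain ⟨v⟩ := ‹Nonempty V›
  have hd0 : (d : ℂ) ≠ 0 := by exact_mod_cast hd
  have hcard : (Fintype.card V : ℂ) ≠ 0 := by
    exact_mod_cast (Fintype.card_pos_iff.2 ⟨v⟩).ne'
  set P := G.walkMat d with hP
  set f : V → ℂ := Pi.single v 1 - fun _ => (Fintype.card V : ℂ)⁻¹ with hf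
  have hfsum : ∑ w, f w = 0 := by
    simp [hf, Finset.sum_sub_distrib, hcard]
  have hz := sum_sq_norm_walkMat_pow_mulVec_le hG hd zero_lt_one hsec hr hfsum (r + 1)
  rw [zero_pow (by omega : r + 1 - (r - 1) ≠ 0), mul_zero, zero_pow two_ne_zero, zero_mul] at hz
  have hzero : (P ^ (r + 1)).mulVec f v = 0 := by
    have := (Finset.sum_eq_zero_iff_of_nonneg fun w _ => by positivity).1
      (le_antisymm hz (Finset.sum_nonneg fun w _ => by positivity)) v (Finset.mem_univ v)
    simpa using this
  have hone : ∀ L : ℕ, (P ^ L).mulVec (fun _ => 1) = fun _ => 1 := by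
    intro L
    induction L with
    | zero => simp
    | succ L ih =>
      have h1 : P.mulVec (fun _ => 1) = fun _ => 1 := by
        ext i; simpa [Matrix.mulVec, dotProduct] using sum_walkMat_row hG hd i
      rw [pow_succ, ← Matrix.mulVec_mulVec, h1, ih]
  have hentry : (P ^ (r + 1)) v v = (Fintype.card V : ℂ)⁻¹ := by
    have hc : (fun _ => (Fintype.card V : ℂ)⁻¹ : V → ℂ) =
        (Fintype.card V : ℂ)⁻¹ • fun _ => (1 : ℂ) := by ext; simp
    rw [hf, hc, Matrix.mulVec_sub, Matrix.mulVec_smul, hone] at hzero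
    simpa [sub_eq_zero] using hzero
  -- The entries of the powers of the adjacency matrix are natural numbers.
  let N : Matrix V V ℕ := fun i j => if G.Adj i j then 1 else 0
  have hN : G.adjMat = N.map (Nat.castRingHom ℂ) := by
    ext i j
    rw [Matrix.map_apply]
    simp only [adjMat, N]
    split_ifs <;> simp
  have hA : G.adjMat = (d : ℂ) • P := by
    rw [hP, walkMat, smul_smul, mul_inv_cancel₀ hd0, one_smul]
  have hNat : ((N ^ (r + 1)) v v : ℂ) * Fintype.card V = d ^ (r + 1) := by
    have h1 : (G.adjMat ^ (r + 1)) v v = ((N ^ (r + 1)) v v : ℂ) := by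
      rw [hN, ← Matrix.map_pow]; simp
    rw [← h1, hA, smul_pow, Matrix.smul_apply, hentry, smul_eq_mul, mul_assoc,
      inv_mul_cancel₀ hcard, mul_one]
  have hNat' : (N ^ (r + 1)) v v * Fintype.card V = d ^ (r + 1) := by exact_mod_cast hNat
  exact Nat.le_of_dvd (by positivity) ⟨_, by rw [← hNat', mul_comm]⟩

/-! ### Uniform random walks on a regular graph -/

namespace Digraph

variable {V : Type*} [Fintype V] [MeasurableSpace V] [DiscreteMeasurableSpace V]
  {Ω : Type*} [MeasurableSpace Ω]

/-- The `V`-valued process `col` is a stationary uniform random walk along the edges of `G`. Only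
the two possible masses of a word and the admissibility of single steps are recorded; for a
`d`-regular graph they determine the transition probabilities. -/
structure IsUniformWalk (G : Digraph V) (d : ℕ) (μ : Measure Ω) (col : ℕ → Ω → V) : Prop where
  measurable : ∀ j, Measurable (col j)
  adj : ∀ j v v', μ.real {ω | col j ω = v ∧ col (j + 1) ω = v'} ≠ 0 → G.Adj v v'
  word : ∀ m (w : Fin (m + 1) → V), μ.real {ω | ∀ i : Fin (m + 1), col i ω = w i} = 0 ∨
    μ.real {ω | ∀ i : Fin (m + 1), col i ω = w i} = ((Fintype.card V : ℝ) * d ^ m)⁻¹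
  stationary : ∀ j v, μ.real {ω | col j ω = v} = (Fintype.card V : ℝ)⁻¹

namespace IsUniformWalk

variable {G : Digraph V} {d : ℕ} {μ : Measure Ω} {col : ℕ → Ω → V}

theorem measurableSet_word (h : G.IsUniformWalk d μ col) {m : ℕ} (w : Fin m → V) :
    MeasurableSet {ω | ∀ i : Fin m, col i ω = w i} := by
  simp only [Set.ofPred_forall]
  exact MeasurableSet.iInter fun i => h.measurable i (MeasurableSet.of_discrete (s := {w i}))

variable [IsProbabilityMeasure μ]

theorem sum_word_snoc (h : G.IsUniformWalk d μ col) {m : ℕ} (w : Fin (m + 1) → V) :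
    ∑ v, μ.real {ω | ∀ i : Fin (m + 2), col i ω = (Fin.snoc w v : Fin (m + 2) → V) i} =
      μ.real {ω | ∀ i : Fin (m + 1), col i ω = w i} := by
  classical
  rw [← measureReal_biUnion_finset]
  · congr 1
    ext ω
    simp only [Set.mem_iUnion, Set.mem_ofPred_eq, Finset.mem_univ, exists_prop, true_and]
    constructor
    · rintro ⟨v, hv⟩ i
      simpa using hv i.castSucc
    · intro hω
      refine ⟨col (m + 1) ω, fun i => ?_⟩
      induction i using Fin.lastCases with
      | last => simp
      | cast i => simpa using hω i
  · intro v _ v' _ hne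
    rw [Function.onFun, Set.disjoint_left]
    intro ω hv hv'
    have h1 := hv (Fin.last (m + 1))
    have h2 := hv' (Fin.last (m + 1))
    simp only [Fin.snoc_last] at h1 h2
    exact hne (h1.symm.trans h2)
  · exact fun v _ => h.measurableSet_word _

/-- Each of the at most `d` admissible continuations of a word carries at most a `d`-th part of
its mass, and together they carry all of it; hence each carries exactly a `d`-th part. -/
theorem real_word_snoc (h : G.IsUniformWalk d μ col) (hG : G.IsRegular d) (hd : d ≠ 0) {m : ℕ}
    (w : Fin (m + 1) → V) (v : V) :
    (μ.real {ω | ∀ i : Fin (m + 2), col i ω = (Fin.snoc w v : Fin (m + 2) → V) i} : ℂ) =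
      μ.real {ω | ∀ i : Fin (m + 1), col i ω = w i} * G.walkMat d (w (Fin.last m)) v := by
  classical
  set c := μ.real {ω | ∀ i : Fin (m + 1), col i ω = w i} with hc
  set q : V → ℝ := fun v =>
    μ.real {ω | ∀ i : Fin (m + 2), col i ω = (Fin.snoc w v : Fin (m + 2) → V) i} with hq
  have hsum : ∑ v, q v = c := h.sum_word_snoc w
  have hq0 : ∀ v, 0 ≤ q v := fun v => measureReal_nonneg
  have hadj : ∀ v, ¬ G.Adj (w (Fin.last m)) v → q v = 0 := by
    intro v hv
    by_contra hne
    refine hv (h.adj m _ _ fun h0 => hne (le_antisymm ?_ (hq0 v)))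
    rw [← h0]
    refine measureReal_mono fun ω hω => ⟨?_, ?_⟩
    · simpa using hω (Fin.last m).castSucc
    · simpa using hω (Fin.last (m + 1))
  have hqc : ∀ v, q v ≤ c / d := by
    intro v
    have hdpos : (0 : ℝ) < d := by exact_mod_cast Nat.pos_of_ne_zero hd
    rcases h.word _ (Fin.snoc w v : Fin (m + 2) → V) with h0 | h1
    · exact h0.le.trans (div_nonneg measureReal_nonneg hdpos.le)
    · rcases h.word _ w with h0 | h2
      · have : q v ≤ c := hsum ▸ Finset.single_le_sum (fun v _ => hq0 v) (Finset.mem_univ v)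
        rw [hc, h0] at this
        rw [hc, h0, zero_div]; exact this
      · rw [hc, h2]
        refine (h1.trans ?_).le
        rw [pow_succ, ← mul_assoc, mul_inv, div_eq_mul_inv]
  have hfull : ∀ v, q v = if G.Adj (w (Fin.last m)) v then c / d else 0 := by
    have hle : ∀ v ∈ Finset.univ, q v ≤ if G.Adj (w (Fin.last m)) v then c / d else 0 := by
      intro v _
      split_ifs with hv
      · exact hqc v
      · exact (hadj v hv).le
    have htot : ∑ v, (if G.Adj (w (Fin.last m)) v then c / d else 0) = c := by
      rw [← Finset.sum_filter, Finset.sum_const, nsmul_eq_mul]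
      have : (Finset.univ.filter fun v => G.Adj (w (Fin.last m)) v).card = d := by
        rw [← hG.1 (w (Fin.last m)), Set.ncard_eq_toFinset_card']
        simp
      rw [this]
      field_simp
    intro v
    exact (Finset.sum_eq_sum_iff_of_le hle).1 (hsum.trans htot.symm) v (Finset.mem_univ v)
  change (q v : ℂ) = _
  rw [hfull v, walkMat, Matrix.smul_apply, adjMat]
  split_ifs <;> simp [div_eq_mul_inv]

/-- The infinite word that agrees with `w` up to place `m` and is constant afterwards. -/
def extendWord {m : ℕ} (w : Fin (m + 1) → V) (i : ℕ) : V :=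
  w ⟨min i m, by omega⟩

theorem integrable_comp (h : G.IsUniformWalk d μ col) {m : ℕ} {g : (ℕ → V) → ℂ}
    (hg : DependsOn g (Set.Iic m)) : Integrable (fun ω => g fun i => col i ω) μ := by
  have hm : Measurable fun ω => fun i : Fin (m + 1) => col i ω :=
    measurable_pi_lambda _ fun i => h.measurable i
  have e : (fun ω => g fun i => col i ω) =
      (fun w : Fin (m + 1) → V => g (extendWord w)) ∘ fun ω => fun i : Fin (m + 1) => col i ω := by
    ext ω
    refine hg fun i hi => ?_
    simp [extendWord, min_eq_left (Set.mem_Iic.1 hi)]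
  rw [e]
  exact (Integrable.of_finite (μ := μ.map _)).comp_measurable hm

theorem integral_comp (h : G.IsUniformWalk d μ col) {m : ℕ} {g : (ℕ → V) → ℂ}
    (hg : DependsOn g (Set.Iic m)) : ∫ ω, g (fun i => col i ω) ∂μ =
      ∑ w : Fin (m + 1) → V,
        (μ.real {ω | ∀ i : Fin (m + 1), col i ω = w i} : ℂ) * g (extendWord w) := by
  have hm : Measurable fun ω => fun i : Fin (m + 1) => col i ω :=
    measurable_pi_lambda _ fun i => h.measurable i
  have e : (fun ω => g fun i => col i ω) = fun ω =>
      (fun w : Fin (m + 1) → V => g (extendWord w)) fun i : Fin (m + 1) => col i ω := by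
    ext ω
    refine hg fun i hi => ?_
    simp [extendWord, min_eq_left (Set.mem_Iic.1 hi)]
  rw [e, ← integral_map hm.aemeasurable
    (measurable_of_finite fun w : Fin (m + 1) → V => g (extendWord w)).aestronglyMeasurable,
    integral_fintype Integrable.of_finite]
  refine Finset.sum_congr rfl fun w _ => ?_
  rw [map_measureReal_apply hm (measurableSet_singleton w), Complex.real_smul]
  congr 3
  ext ω
  simp [funext_iff]

/-- The Markov property in integrated form. -/
theorem integral_succ (h : G.IsUniformWalk d μ col) (hG : G.IsRegular d) (hd : d ≠ 0) {m : ℕ}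
    {g : (ℕ → V) → ℂ} (hg : DependsOn g (Set.Iic (m + 1))) :
    ∫ ω, g (fun i => col i ω) ∂μ = ∫ ω, (fun y : ℕ → V =>
      ∑ v, G.walkMat d (y m) v * g (open Classical in Function.update y (m + 1) v))
        (fun i => col i ω) ∂μ := by
  classical
  have hg' : DependsOn (fun y : ℕ → V =>
      ∑ v, G.walkMat d (y m) v * g (Function.update y (m + 1) v)) (Set.Iic m) := by
    intro x y hxy
    refine Finset.sum_congr rfl fun v _ => ?_
    rw [hxy m (Set.mem_Iic.2 le_rfl)]
    congr 1
    refine hg fun i hi => ?_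
    rcases eq_or_ne i (m + 1) with rfl | hne
    · simp
    · have : i ≤ m := by have := Set.mem_Iic.1 hi; omega
      simp [hne, hxy i this]
  rw [h.integral_comp hg]
  refine Eq.trans ?_ (h.integral_comp hg').symm
  rw [← (Fin.snocEquiv fun _ : Fin (m + 2) => V).sum_comp, Fintype.sum_prod_type, Finset.sum_comm]
  refine Finset.sum_congr rfl fun w _ => ?_
  rw [Finset.mul_sum]
  refine Finset.sum_congr rfl fun v _ => ?_
  simp only [Fin.snocEquiv_apply]
  rw [h.real_word_snoc hG hd, mul_assoc]
  congr 2
  · simp [extendWord, Fin.last]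
  · refine hg fun i hi => ?_
    rcases eq_or_ne i (m + 1) with rfl | hne
    · simp only [extendWord, min_self, Function.update_self]
      exact Fin.snoc_last (α := fun _ => V) v w
    · have hi' : i ≤ m := by have := Set.mem_Iic.1 hi; omega
      simp only [extendWord, Function.update_of_ne hne, min_eq_left hi',
        min_eq_left (hi'.trans (Nat.le_succ m))]
      exact Fin.snoc_castSucc (α := fun _ => V) v w ⟨i, by omega⟩

/-- Given the walk up to time `a`, a bounded function of the walk from time `a` on can be replaced
by a function, with the same bound, of its position at time `a`. -/
theorem exists_integral_mul_eq (h : G.IsUniformWalk d μ col) (hG : G.IsRegular d) (hd : d ≠ 0)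
    (a : ℕ) {B : ℝ} (K : ℕ) {f : (ℕ → V) → ℂ}
    (hf : DependsOn f (Set.Icc a (a + K))) (hB : ∀ y, ‖f y‖ ≤ B) :
    ∃ u : V → ℂ, (∀ v, ‖u v‖ ≤ B) ∧ ∀ φ : (ℕ → V) → ℂ, DependsOn φ (Set.Iic a) →
      ∫ ω, φ (fun i => col i ω) * f (fun i => col i ω) ∂μ =
        ∫ ω, φ (fun i => col i ω) * u (col a ω) ∂μ := by
  classical
  induction K generalizing f with
  | zero =>
    refine ⟨fun v => f fun _ => v, fun v => hB _, fun φ _ => ?_⟩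
    congr 1; ext ω; congr 1
    refine hf fun i hi => ?_
    rw [show i = a by simpa using hi]
  | succ K ih =>
    set f₁ : (ℕ → V) → ℂ := fun y =>
      ∑ v, G.walkMat d (y (a + K)) v * f (Function.update y (a + K + 1) v) with hf₁
    have hdep : DependsOn f₁ (Set.Icc a (a + K)) := by
      intro x y hxy
      refine Finset.sum_congr rfl fun v _ => ?_
      rw [hxy (a + K) ⟨by omega, le_rfl⟩]
      congr 1
      refine hf fun i hi => ?_
      rcases eq_or_ne i (a + K + 1) with rfl | hne
      · simp
      · have hi2 : i ≤ a + K := by have := hi.2; omega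
        simp [hne, hxy i ⟨hi.1, hi2⟩]
    have hB₁ : ∀ y, ‖f₁ y‖ ≤ B := by
      intro y
      have hrow := sum_walkMat_row hG hd (y (a + K))
      rw [Finset.sum_congr rfl fun j _ => walkMat_eq_norm G d (y (a + K)) j,
        ← Complex.ofReal_sum] at hrow
      calc ‖f₁ y‖ ≤ ∑ v, ‖G.walkMat d (y (a + K)) v‖ * B := by
            refine (norm_sum_le _ _).trans (Finset.sum_le_sum fun v _ => ?_)
            rw [norm_mul]; gcongr; exact hB _
        _ = B := by
            rw [← Finset.sum_mul]
            have : ∑ v, ‖G.walkMat d (y (a + K)) v‖ = 1 := by exact_mod_cast hrow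
            rw [this, one_mul]
    obtain ⟨u, hu, hφ⟩ := ih hdep hB₁
    refine ⟨u, hu, fun φ hdφ => ?_⟩
    rw [← hφ φ hdφ]
    have hdprod : DependsOn (fun y => φ y * f y) (Set.Iic (a + K + 1)) := by
      intro x y hxy
      change φ x * f x = φ y * f y
      rw [hdφ fun i hi => hxy i ((Set.mem_Iic.1 hi).trans (by omega)),
        hf fun i hi => hxy i hi.2]
    rw [h.integral_succ hG hd hdprod]
    congr 1; ext ω
    rw [hf₁, Finset.mul_sum]
    refine Finset.sum_congr rfl fun v _ => ?_
    have : φ (Function.update (fun i => col i ω) (a + K + 1) v) = φ fun i => col i ω := by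
      refine hdφ fun i hi => ?_
      have := Set.mem_Iic.1 hi
      exact Function.update_of_ne (by omega) _ _
    rw [this]; ring

theorem integral_mul_comp_add (h : G.IsUniformWalk d μ col) (hG : G.IsRegular d) (hd : d ≠ 0)
    {a : ℕ} {φ : (ℕ → V) → ℂ} (hφ : DependsOn φ (Set.Iic a)) (L : ℕ) (u : V → ℂ) :
    ∫ ω, φ (fun i => col i ω) * u (col (a + L) ω) ∂μ = ∫ ω, φ (fun i => col i ω) *
      ((open Classical in G.walkMat d ^ L).mulVec u) (col a ω) ∂μ := by
  classical
  induction L generalizing u with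
  | zero => simp
  | succ L ih =>
    have hdprod : DependsOn (fun y => φ y * u (y (a + L + 1))) (Set.Iic (a + L + 1)) := by
      intro x y hxy
      change φ x * u (x _) = φ y * u (y _)
      rw [hφ fun i hi => hxy i ((Set.mem_Iic.1 hi).trans (by omega)),
        hxy (a + L + 1) (Set.mem_Iic.2 le_rfl)]
    rw [pow_succ, ← Matrix.mulVec_mulVec, ← ih]
    refine (h.integral_succ hG hd hdprod).trans ?_
    congr 1; ext ω
    rw [Matrix.mulVec, dotProduct, Finset.mul_sum]
    refine Finset.sum_congr rfl fun v _ => ?_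
    have : φ (Function.update (fun i => col i ω) (a + L + 1) v) = φ fun i => col i ω := by
      refine hφ fun i hi => ?_
      have := Set.mem_Iic.1 hi
      exact Function.update_of_ne (by omega) _ _
    simp only [this, Function.update_self]; ring

theorem integral_comp_col (h : G.IsUniformWalk d μ col) (j : ℕ) {E : Type*}
    [NormedAddCommGroup E] [NormedSpace ℝ E] [CompleteSpace E] (u : V → E) :
    ∫ ω, u (col j ω) ∂μ = (Fintype.card V : ℝ)⁻¹ • ∑ v, u v := by
  rw [← integral_map (h.measurable j).aemeasurable
    (StronglyMeasurable.of_discrete (f := u)).aestronglyMeasurable,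
    integral_fintype Integrable.of_finite, Finset.smul_sum]
  refine Finset.sum_congr rfl fun v _ => ?_
  rw [map_measureReal_apply (h.measurable j) (measurableSet_singleton v)]
  congr 1
  exact h.stationary j v

/-- Decorrelation of the walk up to time `a` from the walk after time `a + L`: the future is
replaced by a function `u` of the position at time `a + L`, and `u` minus its mean is pushed back to
time `a` by `P ^ L`. -/
theorem norm_integral_mul_sub_le [Nonempty V] (h : G.IsUniformWalk d μ col) (hG : G.IsRegular d)
    (hd : d ≠ 0) {lam : ℝ} (hlam : lam < 1) (hsec : G.secondEigenvalue d / d ≤ lam) {r : ℕ}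
    (hr : IsRNormal G.adjMat r) {a L K : ℕ} {φ f : (ℕ → V) → ℂ} {B B' : ℝ}
    (hφ : DependsOn φ (Set.Iic a)) (hφB : ∀ y, ‖φ y‖ ≤ B')
    (hf : DependsOn f (Set.Icc (a + L) (a + L + K))) (hfB : ∀ y, ‖f y‖ ≤ B) :
    ‖(∫ ω, φ (fun i => col i ω) * f (fun i => col i ω) ∂μ) -
        (∫ ω, φ (fun i => col i ω) ∂μ) * ∫ ω, f (fun i => col i ω) ∂μ‖ ≤
      2 * B' * B * (2 ^ r * max 1 (L : ℝ) ^ (r - 1) * lam ^ (L - (r - 1))) := by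
  classical
  have hlam0 : 0 ≤ lam := (div_nonneg secondEigenvalue_nonneg (Nat.cast_nonneg d)).trans hsec
  have hB' : 0 ≤ B' := (norm_nonneg _).trans (hφB fun _ => Classical.arbitrary V)
  have hB : 0 ≤ B := (norm_nonneg _).trans (hfB fun _ => Classical.arbitrary V)
  set ρ : ℝ := 2 ^ r * max 1 (L : ℝ) ^ (r - 1) * lam ^ (L - (r - 1)) with hρ
  have hρ0 : 0 ≤ ρ := by positivity
  have hcard : (0 : ℝ) < Fintype.card V := by exact_mod_cast Fintype.card_pos
  obtain ⟨u, huB, hu⟩ := h.exists_integral_mul_eq hG hd (a + L) K hf hfB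
  set M : ℂ := (Fintype.card V : ℝ)⁻¹ • ∑ v, u v with hM
  have hMB : ‖M‖ ≤ B := by
    rw [hM, norm_smul, norm_inv, Real.norm_natCast, inv_mul_le_iff₀ hcard]
    refine (norm_sum_le _ _).trans ((Finset.sum_le_sum fun v _ => huB v).trans ?_)
    simp
  have hint : ∫ ω, f (fun i => col i ω) ∂μ = M := by
    have := hu (fun _ => 1) fun _ _ _ => rfl
    simp only [one_mul] at this
    rw [this, h.integral_comp_col]
  set u₀ : V → ℂ := fun v => u v - M with hu₀
  have hu₀sum : ∑ v, u₀ v = 0 := by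
    have hc : (Fintype.card V : ℂ) ≠ 0 := by exact_mod_cast hcard.ne'
    simp only [hu₀, Finset.sum_sub_distrib, Finset.sum_const, Finset.card_univ, nsmul_eq_mul, hM,
      Complex.real_smul]
    push_cast
    rw [← mul_assoc, mul_inv_cancel₀ hc, one_mul, sub_self]
  have hφ' : DependsOn φ (Set.Iic (a + L)) := fun x y hxy =>
    hφ fun i hi => hxy i ((Set.mem_Iic.1 hi).trans (by omega))
  have hφint : Integrable (fun ω => φ fun i => col i ω) μ := h.integrable_comp hφ
  have huint : Integrable (fun ω => φ (fun i => col i ω) * u (col (a + L) ω)) μ := by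
    refine h.integrable_comp (m := a + L) (g := fun y => φ y * u (y (a + L))) fun x y hxy => ?_
    change φ x * u (x _) = φ y * u (y _)
    rw [hφ' hxy, hxy (a + L) (Set.mem_Iic.2 le_rfl)]
  have hcov : (∫ ω, φ (fun i => col i ω) * f (fun i => col i ω) ∂μ) -
      (∫ ω, φ (fun i => col i ω) ∂μ) * ∫ ω, f (fun i => col i ω) ∂μ =
      ∫ ω, φ (fun i => col i ω) * ((G.walkMat d ^ L).mulVec u₀) (col a ω) ∂μ := by
    rw [← h.integral_mul_comp_add hG hd hφ, hu φ hφ', hint, ← integral_mul_const,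
      ← integral_sub huint (hφint.mul_const M)]
    simp only [hu₀, mul_sub]
  set x := (G.walkMat d ^ L).mulVec u₀ with hx
  have hsq : ∑ v, ‖x v‖ ^ 2 ≤ ρ ^ 2 * (Fintype.card V * (2 * B) ^ 2) := by
    refine (sum_sq_norm_walkMat_pow_mulVec_le hG hd hlam hsec hr hu₀sum L).trans ?_
    gcongr
    calc ∑ v, ‖u₀ v‖ ^ 2 ≤ ∑ _v : V, (2 * B) ^ 2 := by
          gcongr with v
          exact (norm_sub_le _ _).trans (by linarith [huB v])
      _ = _ := by simp
  have hsum : ∑ v, ‖x v‖ ≤ Fintype.card V * ρ * (2 * B) := by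
    refine (sq_le_sq₀ (Finset.sum_nonneg fun _ _ => norm_nonneg _) (by positivity)).1 ?_
    calc (∑ v, ‖x v‖) ^ 2 ≤ Fintype.card V * ∑ v, ‖x v‖ ^ 2 := by
          simpa using sq_sum_le_card_mul_sum_sq (s := Finset.univ) (f := fun v => ‖x v‖)
      _ ≤ Fintype.card V * (ρ ^ 2 * (Fintype.card V * (2 * B) ^ 2)) := by gcongr
      _ = _ := by ring
  rw [hcov]
  calc ‖∫ ω, φ (fun i => col i ω) * x (col a ω) ∂μ‖
      ≤ ∫ ω, B' * ‖x (col a ω)‖ ∂μ := by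
        refine norm_integral_le_of_norm_le ?_ (Eventually.of_forall fun ω => ?_)
        · refine Integrable.const_mul ?_ B'
          exact (Integrable.of_finite (μ := μ.map (col a)) (f := fun v => ‖x v‖)).comp_measurable
            (h.measurable a)
        · rw [norm_mul]; gcongr; exact hφB _
    _ = B' * ((Fintype.card V : ℝ)⁻¹ * ∑ v, ‖x v‖) := by
        rw [integral_const_mul, h.integral_comp_col a fun v => ‖x v‖, smul_eq_mul]
    _ ≤ B' * ((Fintype.card V : ℝ)⁻¹ * (Fintype.card V * ρ * (2 * B))) := by gcongr
    _ = 2 * B' * B * ρ := by field_simp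

end IsUniformWalk
end Digraph

/-! ### Counting the extensions of patterns -/

/-- On `X`, the value of `g` determines that of `f`, and every value of `f` arises from exactly
`k` values of `g`. -/
def IsRefinement {Ω α β : Type*} (X : Set Ω) (f : Ω → α) (g : Ω → β) (k : ℕ) : Prop :=
  (∀ x ∈ X, ∀ y ∈ X, g x = g y → f x = f y) ∧ ∀ x ∈ X, (g '' {y ∈ X | f y = f x}).ncard = k

theorem IsRefinement.refl {Ω α : Type*} (X : Set Ω) (f : Ω → α) : IsRefinement X f f 1 := by
  refine ⟨fun _ _ _ _ h => h, fun x hx => ?_⟩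
  rw [Set.ncard_eq_one]
  refine ⟨f x, Set.eq_singleton_iff_unique_mem.2 ⟨⟨x, ⟨hx, rfl⟩, rfl⟩, ?_⟩⟩
  rintro _ ⟨y, hy, rfl⟩
  exact hy.2

theorem IsRefinement.trans {Ω α β γ : Type*} [Finite β] [Finite γ] {X : Set Ω} {f : Ω → α}
    {g : Ω → β} {h : Ω → γ} {k l : ℕ} (hfg : IsRefinement X f g k) (hgh : IsRefinement X g h l) :
    IsRefinement X f h (k * l) := by
  classical
  refine ⟨fun x hx y hy e => hfg.1 x hx y hy (hgh.1 x hx y hy e), fun x hx => ?_⟩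
  let π : γ → β := fun c => if hc : ∃ y ∈ X, h y = c then g hc.choose else g x
  have hπ : ∀ y ∈ X, π (h y) = g y := by
    intro y hy
    have hc : ∃ z ∈ X, h z = h y := ⟨y, hy, rfl⟩
    simp only [π, dif_pos hc]
    exact hgh.1 _ hc.choose_spec.1 _ hy hc.choose_spec.2
  set A := h '' {y ∈ X | f y = f x}
  set B := g '' {y ∈ X | f y = f x} with hB
  have hAf : A.Finite := Set.toFinite A
  have hBf : B.Finite := Set.toFinite B
  have hmaps : ∀ c ∈ hAf.toFinset, π c ∈ hBf.toFinset := by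
    intro c hc
    rw [Set.Finite.mem_toFinset] at hc ⊢
    obtain ⟨y, hy, rfl⟩ := hc
    rw [hπ y hy.1]
    exact ⟨y, hy, rfl⟩
  rw [Set.ncard_eq_toFinset_card A hAf, Finset.card_eq_sum_card_fiberwise hmaps,
    Finset.sum_const_nat (m := l), ← Set.ncard_eq_toFinset_card B hBf, hfg.2 x hx]
  intro b hb
  rw [Set.Finite.mem_toFinset] at hb
  obtain ⟨y, hy, rfl⟩ := hb
  rw [← hgh.2 y hy.1, ← Set.ncard_coe_finset]
  congr 1
  ext c
  simp only [Finset.coe_filter, Set.Finite.mem_toFinset, Set.mem_ofPred_eq]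
  constructor
  · rintro ⟨⟨z, hz, rfl⟩, hc⟩
    rw [hπ z hz.1] at hc
    exact ⟨z, ⟨hz.1, hc⟩, rfl⟩
  · rintro ⟨z, hz, rfl⟩
    exact ⟨⟨z, ⟨hz.1, (hfg.1 _ hz.1 _ hy.1 hz.2).trans hy.2⟩, rfl⟩, (hπ z hz.1).trans hz.2⟩

namespace Subshift

variable {W : Type*} [TopologicalSpace W] {X : Subshift W} {d : ℕ}

theorem window_shiftConfig {W : Type*} (a c : ℤ × ℤ) (x : ℤ × ℤ → W) (m n : ℕ) :
    window (shiftConfig a x) c m n = window x (a + c) m n := by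
  ext ij; simp [window, shiftConfig, add_assoc]

theorem occurs_window {x : ℤ × ℤ → W} (hx : x ∈ X.carrier) (c : ℤ × ℤ) (m n : ℕ) :
    X.Occurs (window x c m n) :=
  ⟨shiftConfig c x, X.shift_mem' c x hx, by rw [window_shiftConfig, add_zero]⟩

theorem Occurs.exists_window {m n : ℕ} {p : Fin m × Fin n → W} (hp : X.Occurs p) (c : ℤ × ℤ) :
    ∃ x ∈ X.carrier, window x c m n = p := by
  obtain ⟨x, hx, rfl⟩ := hp
  exact ⟨shiftConfig (-c) x, X.shift_mem' _ x hx, by rw [window_shiftConfig, neg_add_cancel]⟩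

theorem isRefinement_of_ncard {m n m' n' : ℕ} {c c' : ℤ × ℤ}
    (ρ : (Fin m' × Fin n' → W) → (Fin m × Fin n → W))
    (hρ : ∀ x, ρ (window x c' m' n') = window x c m n)
    (h : ∀ p, X.Occurs p → {q | X.Occurs q ∧ ρ q = p}.ncard = d) :
    IsRefinement X.carrier (window · c m n) (window · c' m' n') d := by
  refine ⟨fun x _ y _ e => ?_, fun x hx => ?_⟩
  · simp only at e ⊢
    rw [← hρ, e, hρ]
  · rw [← h _ (occurs_window hx c m n)]
    congr 1
    ext q
    constructor
    · rintro ⟨y, hy, rfl⟩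
      exact ⟨occurs_window hy.1 _ _ _, (hρ y).trans hy.2⟩
    · rintro ⟨hq, hq'⟩
      obtain ⟨y, hy, rfl⟩ := hq.exists_window c'
      exact ⟨y, ⟨hy, (hρ y).symm.trans hq'⟩, rfl⟩

theorem IsRegular.isRefinement_right (h : X.IsRegular d) {m n : ℕ} (hm : 1 ≤ m) (hn : 1 ≤ n)
    (c : ℤ × ℤ) :
    IsRefinement X.carrier (window · c m n) (window · c (m + 1) n) d :=
  isRefinement_of_ncard (fun q ij => q (ij.1.castSucc, ij.2)) (fun _ => rfl) fun p hp => by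
    simpa [funext_iff] using (h.2 m n hm hn p hp).1

theorem IsRegular.isRefinement_left (h : X.IsRegular d) {m n : ℕ} (hm : 1 ≤ m) (hn : 1 ≤ n)
    (c : ℤ × ℤ) :
    IsRefinement X.carrier (window · c m n) (window · (c - (1, 0)) (m + 1) n) d :=
  isRefinement_of_ncard (fun q ij => q (ij.1.succ, ij.2))
    (fun x => by ext ij; simp only [window]; congr 1; ext <;> simp) fun p hp => by
    simpa [funext_iff] using (h.2 m n hm hn p hp).2.1

theorem IsRegular.isRefinement_up (h : X.IsRegular d) {m n : ℕ} (hm : 1 ≤ m) (hn : 1 ≤ n)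
    (c : ℤ × ℤ) :
    IsRefinement X.carrier (window · c m n) (window · c m (n + 1)) d :=
  isRefinement_of_ncard (fun q ij => q (ij.1, ij.2.castSucc)) (fun _ => rfl) fun p hp => by
    simpa [funext_iff] using (h.2 m n hm hn p hp).2.2.1

theorem IsRegular.isRefinement_down (h : X.IsRegular d) {m n : ℕ} (hm : 1 ≤ m) (hn : 1 ≤ n)
    (c : ℤ × ℤ) :
    IsRefinement X.carrier (window · c m n) (window · (c - (0, 1)) m (n + 1)) d :=
  isRefinement_of_ncard (fun q ij => q (ij.1, ij.2.succ))
    (fun x => by ext ij; simp only [window]; congr 1; ext <;> simp) fun p hp => by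
    simpa [funext_iff] using (h.2 m n hm hn p hp).2.2.2

theorem IsRegular.isRefinement_window [Finite W] (h : X.IsRegular d) {m n : ℕ} (hm : 1 ≤ m)
    (hn : 1 ≤ n) (c : ℤ × ℤ) (i i' j j' : ℕ) :
    IsRefinement X.carrier (window · c m n)
      (window · (c - ((i : ℤ), (j : ℤ))) (m + i + i') (n + j + j')) (d ^ (i + i' + j + j')) := by
  induction j' with
  | succ j' ih =>
    exact pow_succ d (i + i' + j + j') ▸ ih.trans (h.isRefinement_up (by omega) (by omega) _)
  | zero =>
  induction j with
  | succ j ih =>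
    have := ih.trans (h.isRefinement_down (by omega) (by omega) _)
    rw [← pow_succ, sub_sub] at this
    simp only [Prod.mk_add_mk, add_zero, Nat.cast_add, Nat.cast_one] at this ⊢
    exact this
  | zero =>
  induction i' with
  | succ i' ih =>
    exact pow_succ d (i + i' + 0 + 0) ▸ ih.trans (h.isRefinement_right (by omega) (by omega) _)
  | zero =>
  induction i with
  | succ i ih =>
    have := ih.trans (h.isRefinement_left (by omega) (by omega) _)
    rw [← pow_succ, sub_sub] at this
    simp only [Prod.mk_add_mk, add_zero, Nat.cast_add, Nat.cast_one, Nat.cast_zero] at this ⊢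
    exact this
  | zero =>
    have e : c - (((0 : ℕ) : ℤ), ((0 : ℕ) : ℤ)) = c := by ext <;> simp
    rw [e]
    exact IsRefinement.refl _ _

theorem ncard_window_image (X : Subshift W) (m n : ℕ) (c : ℤ × ℤ) :
    ((window · c m n) '' X.carrier).ncard = Nat.card (X.Pattern m n) := by
  rw [← Nat.card_coe_set_eq]
  congr 1
  have : (window · c m n) '' X.carrier = {p | X.Occurs p} := by
    ext p
    constructor
    · rintro ⟨x, hx, rfl⟩; exact occurs_window hx _ _ _
    · exact fun hp => hp.exists_window c
  rw [this]; rfl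

theorem IsRegular.card_pattern [Finite W] (h : X.IsRegular d) (hne : X.carrier.Nonempty) {m n : ℕ}
    (hm : 1 ≤ m) (hn : 1 ≤ n) :
    Nat.card (X.Pattern m n) = Nat.card (X.Pattern 1 1) * d ^ (m - 1) * d ^ (n - 1) := by
  obtain ⟨x, hx⟩ := hne
  have h1 : IsRefinement X.carrier (fun _ => ()) (window · 0 1 1) (Nat.card (X.Pattern 1 1)) :=
    ⟨fun _ _ _ _ _ => rfl, fun _ _ => by simpa using ncard_window_image X 1 1 0⟩
  have h2 := (h1.trans (h.isRefinement_window le_rfl le_rfl 0 0 (m - 1) 0 (n - 1))).2 x hx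
  simp only [and_true, Set.ofPred_mem_eq] at h2
  rw [ncard_window_image] at h2
  rw [show 1 + 0 + (m - 1) = m by omega, show 1 + 0 + (n - 1) = n by omega] at h2
  rw [h2]; ring

theorem IsRegular.degree_ne_zero (h : X.IsRegular d) [Finite W] (hne : X.carrier.Nonempty) :
    d ≠ 0 := by
  rintro rfl
  obtain ⟨x, hx⟩ := hne
  have := (h.isRefinement_right le_rfl le_rfl 0).2 x hx
  rw [Set.ncard_eq_zero] at this
  exact (Set.eq_empty_iff_forall_notMem.1 this) _ ⟨x, ⟨hx, rfl⟩, rfl⟩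

end Subshift

/-! ### Existence and uniqueness of the natural measure -/

theorem window_eq_iff {W : Type*} {x y : ℤ × ℤ → W} {c : ℤ × ℤ} {m n : ℕ} :
    window x c m n = window y c m n ↔
      ∀ b : ℤ × ℤ, c.1 ≤ b.1 → b.1 < c.1 + m → c.2 ≤ b.2 → b.2 < c.2 + n → x b = y b := by
  constructor
  · intro h b h1 h2 h3 h4
    have := congrFun h (⟨(b.1 - c.1).toNat, by omega⟩, ⟨(b.2 - c.2).toNat, by omega⟩)
    simp only [window] at this
    have e : c + (((b.1 - c.1).toNat : ℤ), ((b.2 - c.2).toNat : ℤ)) = b := by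
      ext <;> simp <;> omega
    rwa [e] at this
  · intro h
    ext ij
    have h1 := ij.1.isLt
    have h2 := ij.2.isLt
    refine h _ ?_ ?_ ?_ ?_ <;> simp

/-- The pattern of `x` in the square of side `2 k + 1` centred at the origin. -/
def centralBox {W : Type*} (x : ℤ × ℤ → W) (k : ℕ) :
    Fin (2 * k + 1) × Fin (2 * k + 1) → W :=
  window x (-(k : ℤ), -(k : ℤ)) (2 * k + 1) (2 * k + 1)

theorem centralBox_eq_iff {W : Type*} {x y : ℤ × ℤ → W} {k : ℕ} :
    centralBox x k = centralBox y k ↔ ∀ b : ℤ × ℤ, supNorm b ≤ k → x b = y b := by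
  rw [centralBox, centralBox, window_eq_iff]
  refine forall_congr' fun b => ?_
  simp only [supNorm, sup_le_iff]
  push_cast
  constructor
  · intro h hb
    exact h (by omega) (by omega) (by omega) (by omega)
  · intro h h1 h2 h3 h4
    exact h ⟨by omega, by omega⟩

theorem centralBox_eq_of_le {W : Type*} {x y : ℤ × ℤ → W} {k l : ℕ} (hkl : k ≤ l)
    (h : centralBox x l = centralBox y l) : centralBox x k = centralBox y k :=
  centralBox_eq_iff.2 fun b hb => centralBox_eq_iff.1 h b (hb.trans hkl)

namespace Subshift

variable {W : Type*} [TopologicalSpace W] {X : Subshift W} {d : ℕ}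

theorem continuous_window (X : Subshift W) (c : ℤ × ℤ) (m n : ℕ) :
    Continuous fun x : X.carrier => window x.1 c m n :=
  continuous_pi fun _ => (continuous_apply _).comp continuous_subtype_val

theorem cylinder_eq_empty {c : ℤ × ℤ} {m n : ℕ} {p : Fin m × Fin n → W} (hp : ¬ X.Occurs p) :
    {x : X.carrier | window x.1 c m n = p} = ∅ :=
  Set.eq_empty_iff_forall_notMem.2 fun x hx => hp (hx ▸ occurs_window x.2 c m n)

theorem isPiSystem_centralBox (X : Subshift W) :
    IsPiSystem {s | ∃ k p, s = {x : X.carrier | centralBox x.1 k = p}} := by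
  have key : ∀ k l p q, k ≤ l →
      ({x : X.carrier | centralBox x.1 k = p} ∩ {x : X.carrier | centralBox x.1 l = q}).Nonempty →
      {x : X.carrier | centralBox x.1 k = p} ∩ {x : X.carrier | centralBox x.1 l = q} =
        {x : X.carrier | centralBox x.1 l = q} := by
    rintro k l p q hkl ⟨z, rfl, rfl⟩
    exact Set.inter_eq_right.2 fun x hx => centralBox_eq_of_le hkl hx
  rintro _ ⟨k, p, rfl⟩ _ ⟨l, q, rfl⟩ hne
  rcases le_total k l with hkl | hkl
  · exact ⟨l, q, key k l p q hkl hne⟩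
  · rw [Set.inter_comm] at hne ⊢
    exact ⟨k, p, key l k q p hkl hne⟩

theorem continuous_shift (X : Subshift W) (a : ℤ × ℤ) : Continuous (X.shift a) :=
  continuous_induced_rng.2
    (continuous_pi fun b => (continuous_apply (a + b)).comp continuous_subtype_val)

theorem IsRegular.exists_isRefinement_centralBox [Finite W] (h : X.IsRegular d) {m n : ℕ}
    (hm : 1 ≤ m) (hn : 1 ≤ n) (c : ℤ × ℤ) {k : ℕ} (hk : c.1.natAbs + c.2.natAbs + m + n ≤ k) :
    ∃ e, IsRefinement X.carrier (window · c m n) (centralBox · k) (d ^ e) := by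
  have := h.isRefinement_window hm hn c (c.1 + k).toNat (2 * k + 1 - m - (c.1 + k).toNat)
    (c.2 + k).toNat (2 * k + 1 - n - (c.2 + k).toNat)
  rw [show c - (((c.1 + k).toNat : ℤ), ((c.2 + k).toNat : ℤ)) = (-(k : ℤ), -(k : ℤ)) by
      ext <;> simp <;> omega,
    show m + (c.1 + k).toNat + (2 * k + 1 - m - (c.1 + k).toNat) = 2 * k + 1 by omega,
    show n + (c.2 + k).toNat + (2 * k + 1 - n - (c.2 + k).toNat) = 2 * k + 1 by omega] at this
  exact ⟨_, this⟩

variable [DiscreteTopology W]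

theorem isClopen_cylinder (X : Subshift W) (c : ℤ × ℤ) {m n : ℕ} (p : Fin m × Fin n → W) :
    IsClopen {x : X.carrier | window x.1 c m n = p} :=
  (isClopen_discrete {p}).preimage (X.continuous_window c m n)

variable [Finite W]

instance compactSpace_carrier (X : Subshift W) : CompactSpace X.carrier :=
  isCompact_iff_compactSpace.1 X.isClosed'.isCompact

/-- A locally constant function on a subshift depends on finitely many coordinates only. -/
theorem exists_centralBox_of_isLocallyConstant {β : Type*} {f : X.carrier → β}
    (hf : IsLocallyConstant f) :
    ∃ k, ∀ x y : X.carrier, centralBox x.1 k = centralBox y.1 k → f x = f y := by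
  have hloc : ∀ x : X.carrier, ∃ k, ∀ y : X.carrier,
      centralBox y.1 k = centralBox x.1 k → f y = f x := by
    intro x
    obtain ⟨U, hU, hUx⟩ := isOpen_induced_iff.1 (hf.isOpen_fiber (f x))
    have hxU : x.1 ∈ U := by
      have : x ∈ Subtype.val ⁻¹' U := by rw [hUx]; rfl
      exact this
    obtain ⟨I, u, hu, hIu⟩ := isOpen_pi_iff.1 hU x.1 hxU
    refine ⟨I.sup supNorm, fun y hy => ?_⟩
    have hyU : y ∈ Subtype.val ⁻¹' U := hIu fun b hb => by
      rw [centralBox_eq_iff.1 hy b (Finset.le_sup (f := supNorm) hb)]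
      exact (hu b hb).2
    rw [hUx] at hyU
    exact hyU
  choose k hk using hloc
  obtain ⟨t, ht⟩ := isCompact_univ.elim_finite_subcover
    (fun x : X.carrier => {y : X.carrier | centralBox y.1 (k x) = centralBox x.1 (k x)})
    (fun x => (X.isClopen_cylinder _ _).isOpen) fun x _ => Set.mem_iUnion.2 ⟨x, rfl⟩
  refine ⟨t.sup k, fun x y hxy => ?_⟩
  obtain ⟨z, hz, hxz⟩ := Set.mem_iUnion₂.1 (ht (Set.mem_univ x))
  have hyz := (centralBox_eq_of_le (Finset.le_sup (f := k) hz) hxy).symm.trans hxz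
  rw [hk z x hxz, hk z y hyz]

variable [MeasurableSpace W] [DiscreteMeasurableSpace W]

theorem measurableSet_cylinder (X : Subshift W) (c : ℤ × ℤ) {m n : ℕ} (p : Fin m × Fin n → W) :
    MeasurableSet {x : X.carrier | window x.1 c m n = p} :=
  (X.isClopen_cylinder c p).isOpen.measurableSet

theorem generateFrom_centralBox (X : Subshift W) :
    (inferInstance : MeasurableSpace X.carrier) = MeasurableSpace.generateFrom
      {s | ∃ k p, s = {x : X.carrier | centralBox x.1 k = p}} := by
  apply le_antisymm
  · change MeasurableSpace.comap Subtype.val MeasurableSpace.pi ≤ _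
    rw [MeasurableSpace.pi, MeasurableSpace.comap_iSup]
    refine iSup_le fun b => ?_
    rw [MeasurableSpace.comap_comp, ← measurable_iff_comap_le]
    refine @measurable_to_countable' _ _ _ _ (_) _ fun a => ?_
    have : (fun x : X.carrier => x.1 b) ⁻¹' {a} =
        ⋃ p ∈ {p | ∃ x : X.carrier, centralBox x.1 (supNorm b) = p ∧ x.1 b = a},
          {x : X.carrier | centralBox x.1 (supNorm b) = p} := by
      ext x
      simp only [Set.mem_preimage, Set.mem_singleton_iff, Set.mem_iUnion, Set.mem_ofPred_eq,
        exists_prop]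
      constructor
      · exact fun hx => ⟨_, ⟨x, rfl, hx⟩, rfl⟩
      · rintro ⟨_, ⟨y, rfl, hy⟩, hxy⟩
        rw [centralBox_eq_iff.1 hxy b le_rfl, hy]
    change MeasurableSet[MeasurableSpace.generateFrom _] ((fun x : X.carrier => x.1 b) ⁻¹' {a})
    rw [this]
    exact @MeasurableSet.biUnion _ _ (MeasurableSpace.generateFrom _) _ _ (Set.to_countable _)
      fun p _ => MeasurableSpace.measurableSet_generateFrom ⟨_, p, rfl⟩
  · refine MeasurableSpace.generateFrom_le ?_
    rintro _ ⟨k, p, rfl⟩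
    exact X.measurableSet_cylinder _ p

theorem IsNaturalMeasure.eq {μ ν : Measure X.carrier} (hμ : X.IsNaturalMeasure d μ)
    (hν : X.IsNaturalMeasure d ν) : μ = ν := by
  have := hμ.isProbabilityMeasure
  have := hν.isProbabilityMeasure
  refine ext_of_generate_finite _ X.generateFrom_centralBox X.isPiSystem_centralBox ?_ (by simp)
  rintro _ ⟨k, p, rfl⟩
  by_cases hp : X.Occurs p
  · exact (hμ.cylinder _ _ (by omega) (by omega) _ p hp).trans
      (hν.cylinder _ _ (by omega) (by omega) _ p hp).symm
  · simp only [centralBox]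
    rw [cylinder_eq_empty hp, measure_empty, measure_empty]

theorem IsNaturalMeasure.measurePreserving_shift {μ : Measure X.carrier}
    (hμ : X.IsNaturalMeasure d μ) (a : ℤ × ℤ) : MeasurePreserving (X.shift a) μ μ := by
  have := hμ.isProbabilityMeasure
  have hm : Measurable (X.shift a) := (X.continuous_shift a).measurable
  refine ⟨hm, IsNaturalMeasure.eq (d := d)
    ⟨Measure.isProbabilityMeasure_map hm.aemeasurable, ?_⟩ hμ⟩
  intro m n hm1 hn1 c p hp
  rw [Measure.map_apply hm (X.measurableSet_cylinder c p), ← hμ.cylinder m n hm1 hn1 (a + c) p hp]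
  congr 1
  ext x
  change window (shiftConfig a x.1) c m n = p ↔ window x.1 (a + c) m n = p
  rw [window_shiftConfig]

/-- The uniform measures on representatives of the patterns in growing squares give every cylinder
eventually its prescribed mass, so a limit point of them has the prescribed masses. -/
theorem IsRegular.exists_isNaturalMeasure (h : X.IsRegular d) (hne : X.carrier.Nonempty) :
    ∃ μ : Measure X.carrier, X.IsNaturalMeasure d μ := by
  classical
  have hd : d ≠ 0 := h.degree_ne_zero hne
  let S : ℕ → Type _ := fun k => X.Pattern (2 * k + 1) (2 * k + 1)
  have hrep : ∀ k (p : S k), ∃ x : X.carrier, centralBox x.1 k = p.1 := fun k p => by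
    obtain ⟨x, hx, hxp⟩ := p.2.exists_window (-(k : ℤ), -(k : ℤ))
    exact ⟨⟨x, hx⟩, hxp⟩
  choose rep hrep using hrep
  have hS : ∀ k, (Fintype.card (S k) : ENNReal) ≠ 0 := fun k => by
    obtain ⟨x, hx⟩ := hne
    have : Nonempty (S k) := ⟨⟨_, occurs_window hx 0 _ _⟩⟩
    exact_mod_cast Fintype.card_ne_zero
  let ν : ∀ k, Measure X.carrier := fun k =>
    (Fintype.card (S k) : ENNReal)⁻¹ • ∑ p : S k, Measure.dirac (rep k p)
  have hν : ∀ k s, MeasurableSet s →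
      ν k s = (Fintype.card (S k) : ENNReal)⁻¹ * {p | rep k p ∈ s}.ncard := by
    intro k s hs
    simp only [ν, Measure.smul_apply, Measure.finsetSum_apply, smul_eq_mul]
    congr 1
    rw [Set.ncard_eq_toFinset_card', Set.toFinset_ofPred, Finset.card_filter]
    push_cast
    refine Finset.sum_congr rfl fun p _ => ?_
    rw [Measure.dirac_apply' _ hs, Set.indicator_apply]
    rfl
  have hprob : ∀ k, IsProbabilityMeasure (ν k) := fun k => ⟨by
    rw [hν k _ MeasurableSet.univ]
    simp only [Set.mem_univ, Set.ofPred_true, Set.ncard_univ, Nat.card_eq_fintype_card]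
    exact ENNReal.inv_mul_cancel (hS k) (ENNReal.natCast_ne_top _)⟩
  have hcyl : ∀ m n : ℕ, 1 ≤ m → 1 ≤ n → ∀ (c : ℤ × ℤ) (p : Fin m × Fin n → W), X.Occurs p →
      ∀ k : ℕ, c.1.natAbs + c.2.natAbs + m + n ≤ k → ν k {x | window x.1 c m n = p} =
        (((Nat.card (X.Pattern 1 1) * d ^ (m - 1) * d ^ (n - 1) : ℕ) : ENNReal))⁻¹ := by
    intro m n hm hn c p hp k hk
    obtain ⟨e, he⟩ := h.exists_isRefinement_centralBox hm hn c hk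
    obtain ⟨y, hy, rfl⟩ := hp.exists_window c
    have hcount : {q : S k | rep k q ∈
        {x : X.carrier | window x.1 c m n = window y c m n}}.ncard = d ^ e := by
      rw [← he.2 y hy]
      refine (Set.ncard_image_of_injective _ Subtype.val_injective).symm.trans ?_
      congr 1
      ext q
      simp only [Set.mem_image, Set.mem_ofPred_eq]
      constructor
      · rintro ⟨q, hq, rfl⟩
        exact ⟨rep k q, ⟨(rep k q).2, hq⟩, hrep k q⟩
      · rintro ⟨x, ⟨hx, hxy⟩, rfl⟩
        refine ⟨⟨centralBox x k, occurs_window hx _ _ _⟩, ?_, rfl⟩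
        rw [← hxy]
        exact he.1 _ (rep k _).2 _ hx (hrep k _)
    have hcard : Fintype.card (S k) =
        (Nat.card (X.Pattern 1 1) * d ^ (m - 1) * d ^ (n - 1)) * d ^ e := by
      have h1 : IsRefinement X.carrier (fun _ => ()) (window · c m n) (Nat.card (X.Pattern m n)) :=
        ⟨fun _ _ _ _ _ => rfl, fun _ _ => by simpa using ncard_window_image X m n c⟩
      have h2 := (h1.trans he).2 y hy
      simp only [and_true, Set.ofPred_mem_eq] at h2
      rw [← h.card_pattern hne hm hn, ← h2, ← Nat.card_eq_fintype_card]
      exact (ncard_window_image X _ _ _).symm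
    rw [hν k _ (X.measurableSet_cylinder c _), hcount, hcard, Nat.cast_mul _ (d ^ e),
      ENNReal.mul_inv (Or.inr (ENNReal.natCast_ne_top _)) (Or.inl (ENNReal.natCast_ne_top _)),
      mul_assoc, ENNReal.inv_mul_cancel (by exact_mod_cast pow_ne_zero e hd)
        (ENNReal.natCast_ne_top _), mul_one]
  let _ := TopologicalSpace.metrizableSpaceMetric X.carrier
  let νp : ℕ → ProbabilityMeasure X.carrier := fun k => ⟨ν k, hprob k⟩
  obtain ⟨μ, hμ⟩ : ∃ μ, Tendsto νp (hyperfilter ℕ) (𝓝 μ) :=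
    ⟨_, Ultrafilter.le_nhds_lim ((hyperfilter ℕ).map νp)⟩
  refine ⟨μ, inferInstance, fun m n hm hn c p hp => ?_⟩
  have hfr : (μ : Measure X.carrier) (frontier {x | window x.1 c m n = p}) = 0 := by
    rw [isClopen_iff_frontier_eq_empty.1 (X.isClopen_cylinder c p), measure_empty]
  refine tendsto_nhds_unique
    (ProbabilityMeasure.tendsto_measure_of_null_frontier_of_tendsto' hμ hfr) ?_
  refine tendsto_const_nhds.congr' ?_
  filter_upwards [Nat.hyperfilter_le_atTop (eventually_ge_atTop _)] with k hk
  exact (hcyl m n hm hn c p hp k hk).symm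

end Subshift

/-! ### Mixing on `L²` from mixing for locally constant functions -/

namespace Subshift

variable {W : Type*} [TopologicalSpace W] {X : Subshift W} [MeasurableSpace W]
  {μ : Measure X.carrier}

/-- The correlation of `f ∘ σ^n` and `g`. -/
def correlation (X : Subshift W) (μ : Measure X.carrier) (f g : X.carrier → ℂ) (n : ℤ × ℤ) : ℂ :=
  (∫ x, f (X.shift n x) * g x ∂μ) - (∫ x, f x ∂μ) * ∫ x, g x ∂μ

theorem norm_integral_mul_le_eLpNorm {f g : X.carrier → ℂ} (hf : MemLp f 2 μ) (hg : MemLp g 2 μ) :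
    ‖∫ x, f x * g x ∂μ‖ ≤ (eLpNorm f 2 μ).toReal * (eLpNorm g 2 μ).toReal := by
  rw [← ENNReal.toReal_mul, ← toReal_enorm]
  refine ENNReal.toReal_mono (ENNReal.mul_ne_top hf.2.ne hg.2.ne) ?_
  calc ‖∫ x, f x * g x ∂μ‖ₑ ≤ eLpNorm (f • g) 1 μ := by
        rw [eLpNorm_one_eq_lintegral_enorm]
        exact enorm_integral_le_lintegral_enorm _
    _ ≤ _ := eLpNorm_smul_le_mul_eLpNorm hg.1 hf.1

variable [IsProbabilityMeasure μ]

theorem norm_correlation_le (hinv : ∀ a, MeasurePreserving (X.shift a) μ μ)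
    {f g : X.carrier → ℂ} (hf : MemLp f 2 μ) (hg : MemLp g 2 μ) (n : ℤ × ℤ) :
    ‖X.correlation μ f g n‖ ≤ 2 * (eLpNorm f 2 μ).toReal * (eLpNorm g 2 μ).toReal := by
  have h1 : eLpNorm (fun _ : X.carrier => (1 : ℂ)) 2 μ = 1 := by
    rw [eLpNorm_const _ two_ne_zero (IsProbabilityMeasure.ne_zero μ)]; simp
  have hint : ∀ {f : X.carrier → ℂ}, MemLp f 2 μ → ‖∫ x, f x ∂μ‖ ≤ (eLpNorm f 2 μ).toReal := by
    intro f hf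
    simpa [h1] using norm_integral_mul_le_eLpNorm hf (memLp_const (1 : ℂ))
  have h2 := norm_integral_mul_le_eLpNorm (hf.comp_measurePreserving (hinv n)) hg
  rw [eLpNorm_comp_measurePreserving hf.1 (hinv n)] at h2
  calc ‖X.correlation μ f g n‖ ≤ ‖∫ x, f (X.shift n x) * g x ∂μ‖ +
        ‖∫ x, f x ∂μ‖ * ‖∫ x, g x ∂μ‖ := by
        rw [← norm_mul]; exact norm_sub_le _ _
    _ ≤ (eLpNorm f 2 μ).toReal * (eLpNorm g 2 μ).toReal +
        (eLpNorm f 2 μ).toReal * (eLpNorm g 2 μ).toReal := by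
        gcongr
        · exact h2
        · exact hint hf
        · exact hint hg
    _ = _ := by ring

theorem correlation_eq_add (hinv : ∀ a, MeasurePreserving (X.shift a) μ μ)
    {f f' g g' : X.carrier → ℂ} (hf : MemLp f 2 μ) (hf' : MemLp f' 2 μ) (hg : MemLp g 2 μ)
    (hg' : MemLp g' 2 μ) (n : ℤ × ℤ) :
    X.correlation μ f g n = X.correlation μ (f - f') g n + X.correlation μ f' (g - g') n +
      X.correlation μ f' g' n := by
  have hmul : ∀ {f g : X.carrier → ℂ}, MemLp f 2 μ → MemLp g 2 μ →
      Integrable (fun x => f (X.shift n x) * g x) μ := fun hf hg =>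
    (hf.comp_measurePreserving (hinv n)).integrable_mul hg
  have hint : ∀ {f : X.carrier → ℂ}, MemLp f 2 μ → Integrable f μ := fun hf =>
    hf.integrable one_le_two
  simp only [correlation, Pi.sub_apply, sub_mul, mul_sub]
  rw [integral_sub (hmul hf hg) (hmul hf' hg), integral_sub (hmul hf' hg) (hmul hf' hg'),
    integral_sub (hint hf) (hint hf'), integral_sub (hint hg) (hint hg')]
  ring

variable [Finite W] [DiscreteTopology W] [DiscreteMeasurableSpace W]

/-- Clopen sets form an algebra generating the Borel sets, so they approximate measurable sets. -/
theorem exists_isLocallyConstant_eLpNorm_sub_le {f : X.carrier → ℂ}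
    (hf : MemLp f 2 μ) {ε : ENNReal} (hε : ε ≠ 0) :
    ∃ g : X.carrier → ℂ, eLpNorm (f - g) 2 μ ≤ ε ∧ IsLocallyConstant g := by
  refine hf.induction_dense ENNReal.ofNat_ne_top _ ?_ (fun f g hf hg => hf.add hg)
    (fun f hf => hf.continuous.aestronglyMeasurable) hε
  intro c s hs _ ε hε
  have halg : IsSetAlgebra {s : Set X.carrier | IsClopen s} :=
    ⟨isClopen_empty, fun _ h => h.compl, fun _ _ h h' => h.union h'⟩
  have hgen : (inferInstance : MeasurableSpace X.carrier) =
      MeasurableSpace.generateFrom {s : Set X.carrier | IsClopen s} := by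
    refine le_antisymm ?_ (MeasurableSpace.generateFrom_le fun s h => h.isOpen.measurableSet)
    rw [X.generateFrom_centralBox]
    refine MeasurableSpace.generateFrom_mono ?_
    rintro _ ⟨k, p, rfl⟩
    exact X.isClopen_cylinder _ p
  obtain ⟨η, hη, hηs⟩ := exists_eLpNorm_indicator_le (μ := μ) (p := 2) ENNReal.ofNat_ne_top c hε
  obtain ⟨t, ht, hst⟩ := (Measure.MeasureDense.of_generateFrom_isSetAlgebra_finite μ halg
    hgen).approx s hs (measure_ne_top μ s) η (by exact_mod_cast hη)
  refine ⟨t.indicator fun _ => c, ?_,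
    ((LocallyConstant.const X.carrier c).indicator ht).isLocallyConstant⟩
  rw [eLpNorm_indicator_sub_indicator, symmDiff_comm]
  refine hηs _ (hst.le.trans ?_)
  rw [ENNReal.ofReal_coe_nnreal]

/-- Mixing for locally constant functions extends to `L²`, where they are dense. -/
theorem isStronglyMixing_of_isLocallyConstant (hinv : ∀ a, MeasurePreserving (X.shift a) μ μ)
    (h : ∀ f g : X.carrier → ℂ, IsLocallyConstant f → IsLocallyConstant g →
      Tendsto (X.correlation μ f g) (comap supNorm atTop) (𝓝 0)) :
    X.IsStronglyMixing μ := by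
  intro f g hf hg
  rw [← tendsto_sub_nhds_zero_iff]
  change Tendsto (X.correlation μ f g) _ _
  have happrox : ∀ {f : X.carrier → ℂ}, MemLp f 2 μ → ∀ δ : ℝ, 0 < δ →
      ∃ f', IsLocallyConstant f' ∧ MemLp f' 2 μ ∧ (eLpNorm (f - f') 2 μ).toReal ≤ δ := by
    intro f hf δ hδ
    obtain ⟨f', hle, hloc⟩ := exists_isLocallyConstant_eLpNorm_sub_le hf
      (ENNReal.ofReal_pos.2 hδ).ne'
    refine ⟨f', hloc, ?_, ENNReal.toReal_le_of_le_ofReal hδ.le hle⟩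
    have hsub : MemLp (f - f') 2 μ :=
      ⟨hf.1.sub hloc.continuous.aestronglyMeasurable, hle.trans_lt ENNReal.ofReal_lt_top⟩
    simpa using hf.sub hsub
  rw [Metric.tendsto_nhds]
  intro ε hε
  set a := (eLpNorm g 2 μ).toReal with ha
  have ha0 : 0 ≤ a := ENNReal.toReal_nonneg
  obtain ⟨f', hf'loc, hf', hff'⟩ := happrox hf (ε / (6 * (a + 1))) (by positivity)
  set b := (eLpNorm f' 2 μ).toReal with hb
  have hb0 : 0 ≤ b := ENNReal.toReal_nonneg
  obtain ⟨g', hg'loc, hg', hgg'⟩ := happrox hg (ε / (6 * (b + 1))) (by positivity)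
  filter_upwards [(Metric.tendsto_nhds.1 (h f' g' hf'loc hg'loc)) (ε / 3) (by positivity)]
    with n hn
  rw [dist_zero_right] at hn ⊢
  rw [correlation_eq_add hinv hf hf' hg hg']
  have h1 : ‖X.correlation μ (f - f') g n‖ ≤ ε / 3 := by
    calc _ ≤ 2 * (eLpNorm (f - f') 2 μ).toReal * a := norm_correlation_le hinv (hf.sub hf') hg n
      _ ≤ 2 * (ε / (6 * (a + 1))) * (a + 1) := by gcongr; linarith
      _ = ε / 3 := by field_simp; norm_num
  have h2 : ‖X.correlation μ f' (g - g') n‖ ≤ ε / 3 := by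
    calc _ ≤ 2 * b * (eLpNorm (g - g') 2 μ).toReal := norm_correlation_le hinv hf' (hg.sub hg') n
      _ ≤ 2 * (b + 1) * (ε / (6 * (b + 1))) := by gcongr; linarith
      _ = ε / 3 := by field_simp; norm_num
  calc _ ≤ ‖X.correlation μ (f - f') g n‖ + ‖X.correlation μ f' (g - g') n‖ +
        ‖X.correlation μ f' g' n‖ := norm_add₃_le
    _ < ε / 3 + ε / 3 + ε / 3 := by linarith
    _ = ε := by ring

end Subshift

/-! ### Strips of a subshift as random walks -/

namespace Subshift

variable {W : Type*} [TopologicalSpace W] {X : Subshift W} {d : ℕ}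

instance (X : Subshift W) (m n : ℕ) : MeasurableSpace (X.Pattern m n) := ⊤

instance (X : Subshift W) (m n : ℕ) : DiscreteMeasurableSpace (X.Pattern m n) := ⟨fun _ => trivial⟩

/-- The column of height `N` that `x` shows `j` steps to the right of `b`. -/
def columnAt (X : Subshift W) (b : ℤ × ℤ) (N j : ℕ) (x : X.carrier) : X.Pattern 1 N :=
  ⟨window x.1 (b + ((j : ℤ), 0)) 1 N, occurs_window x.2 _ _ _⟩

/-- The row of length `N` that `x` shows `j` steps above `b`. -/
def rowAt (X : Subshift W) (b : ℤ × ℤ) (N j : ℕ) (x : X.carrier) : X.Pattern N 1 :=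
  ⟨window x.1 (b + (0, (j : ℤ))) N 1, occurs_window x.2 _ _ _⟩

theorem columnAt_eq_iff {b : ℤ × ℤ} {N j : ℕ} {x : X.carrier} {v : X.Pattern 1 N} :
    X.columnAt b N j x = v ↔ window x.1 (b + ((j : ℤ), 0)) 1 N = v.1 :=
  Subtype.ext_iff

theorem rowAt_eq_iff {b : ℤ × ℤ} {N j : ℕ} {x : X.carrier} {v : X.Pattern N 1} :
    X.rowAt b N j x = v ↔ window x.1 (b + (0, (j : ℤ))) N 1 = v.1 :=
  Subtype.ext_iff

variable [MeasurableSpace W] {μ : Measure X.carrier}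

theorem IsNaturalMeasure.real_cylinder (hμ : X.IsNaturalMeasure d μ) {m n : ℕ} (hm : 1 ≤ m)
    (hn : 1 ≤ n) (c : ℤ × ℤ) {p : Fin m × Fin n → W} (hp : X.Occurs p) :
    μ.real {x | window x.1 c m n = p} =
      ((Nat.card (X.Pattern 1 1) * d ^ (m - 1) * d ^ (n - 1) : ℕ) : ℝ)⁻¹ := by
  rw [measureReal_def, hμ.cylinder m n hm hn c p hp, ENNReal.toReal_inv, ENNReal.toReal_natCast]

variable [Finite W] [DiscreteTopology W] [DiscreteMeasurableSpace W]

theorem IsNaturalMeasure.isUniformWalk_columnAt (hμ : X.IsNaturalMeasure d μ)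
    (hX : X.IsRegular d) (hne : X.carrier.Nonempty) (b : ℤ × ℤ) {N : ℕ} (hN : 1 ≤ N) :
    (X.horizontalGraph N).IsUniformWalk d μ (X.columnAt b N) := by
  have hcard : Fintype.card (X.Pattern 1 N) = Nat.card (X.Pattern 1 1) * d ^ (N - 1) := by
    rw [← Nat.card_eq_fintype_card, hX.card_pattern hne le_rfl hN]; simp
  have hfib : ∀ j (v : X.Pattern 1 N), X.columnAt b N j ⁻¹' {v} =
      {x | window x.1 (b + ((j : ℤ), 0)) 1 N = v.1} := fun j v => by
    ext x; exact columnAt_eq_iff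
  refine ⟨fun j => measurable_to_countable' fun v => ?_, ?_, ?_, ?_⟩
  · exact (hfib j v) ▸ X.measurableSet_cylinder _ _
  · intro j v v' hne0
    obtain ⟨x, rfl, rfl⟩ : ∃ x, X.columnAt b N j x = v ∧ X.columnAt b N (j + 1) x = v' := by
      by_contra hcon
      refine hne0 ?_
      have hempty : {ω | X.columnAt b N j ω = v ∧ X.columnAt b N (j + 1) ω = v'} = ∅ :=
        Set.eq_empty_iff_forall_notMem.2 fun x hx => hcon ⟨x, hx⟩
      rw [hempty, measureReal_empty]
    have := occurs_window x.2 (b + ((j : ℤ), 0)) 2 N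
    change X.Occurs _
    convert this using 1
    ext ⟨i, k⟩
    fin_cases i
    · simp [columnAt, window]
    · simp [columnAt, window, add_assoc]
  · intro m w
    have hset : {x | ∀ i : Fin (m + 1), X.columnAt b N i x = w i} =
        {x | window x.1 b (m + 1) N = fun ij => (w ij.1).1 (0, ij.2)} := by
      ext x
      simp only [Set.mem_ofPred_eq, columnAt_eq_iff, funext_iff, Prod.forall]
      refine forall_congr' fun i => ?_
      simp [window, add_assoc]
    rw [hset]
    by_cases hp : X.Occurs fun ij : Fin (m + 1) × Fin N => (w ij.1).1 (0, ij.2)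
    · right
      rw [hμ.real_cylinder (by omega) hN b hp, hcard]
      push_cast
      ring
    · left
      rw [cylinder_eq_empty hp, measureReal_empty]
  · intro j v
    change μ.real (_ ⁻¹' {v}) = _
    rw [hfib, hμ.real_cylinder le_rfl hN _ v.2, hcard]
    simp

theorem IsNaturalMeasure.isUniformWalk_rowAt (hμ : X.IsNaturalMeasure d μ)
    (hX : X.IsRegular d) (hne : X.carrier.Nonempty) (b : ℤ × ℤ) {N : ℕ} (hN : 1 ≤ N) :
    (X.verticalGraph N).IsUniformWalk d μ (X.rowAt b N) := by
  have hcard : Fintype.card (X.Pattern N 1) = Nat.card (X.Pattern 1 1) * d ^ (N - 1) := by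
    rw [← Nat.card_eq_fintype_card, hX.card_pattern hne hN le_rfl]; simp
  have hfib : ∀ j (v : X.Pattern N 1), X.rowAt b N j ⁻¹' {v} =
      {x | window x.1 (b + (0, (j : ℤ))) N 1 = v.1} := fun j v => by
    ext x; exact rowAt_eq_iff
  refine ⟨fun j => measurable_to_countable' fun v => ?_, ?_, ?_, ?_⟩
  · exact (hfib j v) ▸ X.measurableSet_cylinder _ _
  · intro j v v' hne0
    obtain ⟨x, rfl, rfl⟩ : ∃ x, X.rowAt b N j x = v ∧ X.rowAt b N (j + 1) x = v' := by
      by_contra hcon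
      refine hne0 ?_
      have hempty : {ω | X.rowAt b N j ω = v ∧ X.rowAt b N (j + 1) ω = v'} = ∅ :=
        Set.eq_empty_iff_forall_notMem.2 fun x hx => hcon ⟨x, hx⟩
      rw [hempty, measureReal_empty]
    have := occurs_window x.2 (b + (0, (j : ℤ))) N 2
    change X.Occurs _
    convert this using 1
    ext ⟨k, i⟩
    fin_cases i
    · simp [rowAt, window]
    · simp [rowAt, window, add_assoc]
  · intro m w
    have hset : {x | ∀ i : Fin (m + 1), X.rowAt b N i x = w i} =
        {x | window x.1 b N (m + 1) = fun ij => (w ij.2).1 (ij.1, 0)} := by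
      ext x
      simp only [Set.mem_ofPred_eq, rowAt_eq_iff, funext_iff, Prod.forall]
      constructor
      · intro h i j
        simpa [window, add_assoc] using h j i 0
      · intro h i j k
        rw [Subsingleton.elim k 0]
        simpa [window, add_assoc] using h j i
    rw [hset]
    by_cases hp : X.Occurs fun ij : Fin N × Fin (m + 1) => (w ij.2).1 (ij.1, 0)
    · right
      rw [hμ.real_cylinder hN (by omega) b hp, hcard]
      push_cast
      rfl
    · left
      rw [cylinder_eq_empty hp, measureReal_empty]
  · intro j v
    change μ.real (_ ⁻¹' {v}) = _
    rw [hfib, hμ.real_cylinder hN le_rfl _ v.2, hcard]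
    simp

/-- Decorrelation of two windows in a common horizontal strip. The first column of the right window
is `L` steps to the right of the last column of the left one. -/
theorem IsNaturalMeasure.norm_integral_mul_sub_le_right (hμ : X.IsNaturalMeasure d μ)
    (hX : X.IsRegular d) (hne : X.carrier.Nonempty) {lam : ℝ} {r : ℕ}
    (hH : IsExpanderFamily X.horizontalGraph d lam r) {B B' : ℝ} {k : ℕ}
    {F G : (Fin (k + 1) × Fin (k + 1) → W) → ℂ} (hF : ∀ p, ‖F p‖ ≤ B) (hG : ∀ p, ‖G p‖ ≤ B')
    (b : ℤ × ℤ) (p q L : ℕ) :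
    ‖(∫ x, F (window x.1 (b + (((k + L : ℕ) : ℤ), (p : ℤ))) (k + 1) (k + 1)) *
          G (window x.1 (b + (0, (q : ℤ))) (k + 1) (k + 1)) ∂μ) -
        (∫ x, F (window x.1 (b + (((k + L : ℕ) : ℤ), (p : ℤ))) (k + 1) (k + 1)) ∂μ) *
          ∫ x, G (window x.1 (b + (0, (q : ℤ))) (k + 1) (k + 1)) ∂μ‖ ≤
      2 * B' * B * (2 ^ r * max 1 (L : ℝ) ^ (r - 1) * lam ^ (L - (r - 1))) := by
  have := hμ.isProbabilityMeasure
  set N := p + q + k + 1 with hN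
  have hwalk := hμ.isUniformWalk_columnAt hX hne b (N := N) (by omega)
  obtain ⟨hreg, hsec, hr⟩ := hH.2 N (by omega)
  have : Nonempty (X.Pattern 1 N) := let ⟨x, hx⟩ := hne; ⟨⟨_, occurs_window hx 0 _ _⟩⟩
  let φ : (ℕ → X.Pattern 1 N) → ℂ := fun y =>
    G fun ij => (y ij.1).1 (0, ⟨q + ij.2, by omega⟩)
  let f : (ℕ → X.Pattern 1 N) → ℂ := fun y =>
    F fun ij => (y (k + L + ij.1)).1 (0, ⟨p + ij.2, by omega⟩)
  have hφ : DependsOn φ (Set.Iic k) := by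
    intro x y hxy
    simp only [φ]
    congr 1; ext ij
    rw [hxy ij.1 (Set.mem_Iic.2 (by omega))]
  have hf : DependsOn f (Set.Icc (k + L) (k + L + k)) := by
    intro x y hxy
    simp only [f]
    congr 1; ext ij
    rw [hxy (k + L + ij.1) ⟨by omega, by omega⟩]
  have key := hwalk.norm_integral_mul_sub_le hreg (hX.degree_ne_zero hne) hH.1 hsec hr hφ
    (fun _ => hG _) hf (fun _ => hF _)
  have e1 : ∀ x : X.carrier, φ (fun i => X.columnAt b N i x) =
      G (window x.1 (b + (0, (q : ℤ))) (k + 1) (k + 1)) := fun x => by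
    simp only [φ]
    congr 1; ext ij
    refine congrArg x.1 (Prod.ext ?_ ?_) <;> simp [add_assoc]
  have e2 : ∀ x : X.carrier, f (fun i => X.columnAt b N i x) =
      F (window x.1 (b + (((k + L : ℕ) : ℤ), (p : ℤ))) (k + 1) (k + 1)) := fun x => by
    simp only [f]
    congr 1; ext ij
    refine congrArg x.1 (Prod.ext ?_ ?_) <;> simp [add_assoc]
  simp only [e1, e2] at key
  refine le_trans (le_of_eq ?_) key
  simp only [mul_comm]

/-- Decorrelation of two windows in a common vertical strip. The first row of the upper window
is `L` steps above the last row of the lower one. -/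
theorem IsNaturalMeasure.norm_integral_mul_sub_le_up (hμ : X.IsNaturalMeasure d μ)
    (hX : X.IsRegular d) (hne : X.carrier.Nonempty) {lam : ℝ} {r : ℕ}
    (hV : IsExpanderFamily X.verticalGraph d lam r) {B B' : ℝ} {k : ℕ}
    {F G : (Fin (k + 1) × Fin (k + 1) → W) → ℂ} (hF : ∀ p, ‖F p‖ ≤ B) (hG : ∀ p, ‖G p‖ ≤ B')
    (b : ℤ × ℤ) (p q L : ℕ) :
    ‖(∫ x, F (window x.1 (b + ((p : ℤ), ((k + L : ℕ) : ℤ))) (k + 1) (k + 1)) *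
          G (window x.1 (b + ((q : ℤ), 0)) (k + 1) (k + 1)) ∂μ) -
        (∫ x, F (window x.1 (b + ((p : ℤ), ((k + L : ℕ) : ℤ))) (k + 1) (k + 1)) ∂μ) *
          ∫ x, G (window x.1 (b + ((q : ℤ), 0)) (k + 1) (k + 1)) ∂μ‖ ≤
      2 * B' * B * (2 ^ r * max 1 (L : ℝ) ^ (r - 1) * lam ^ (L - (r - 1))) := by
  have := hμ.isProbabilityMeasure
  set N := p + q + k + 1 with hN
  have hwalk := hμ.isUniformWalk_rowAt hX hne b (N := N) (by omega)
  obtain ⟨hreg, hsec, hr⟩ := hV.2 N (by omega)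
  have : Nonempty (X.Pattern N 1) := let ⟨x, hx⟩ := hne; ⟨⟨_, occurs_window hx 0 _ _⟩⟩
  let φ : (ℕ → X.Pattern N 1) → ℂ := fun y =>
    G fun ij => (y ij.2).1 (⟨q + ij.1, by omega⟩, 0)
  let f : (ℕ → X.Pattern N 1) → ℂ := fun y =>
    F fun ij => (y (k + L + ij.2)).1 (⟨p + ij.1, by omega⟩, 0)
  have hφ : DependsOn φ (Set.Iic k) := by
    intro x y hxy
    simp only [φ]
    congr 1; ext ij
    rw [hxy ij.2 (Set.mem_Iic.2 (by omega))]
  have hf : DependsOn f (Set.Icc (k + L) (k + L + k)) := by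
    intro x y hxy
    simp only [f]
    congr 1; ext ij
    rw [hxy (k + L + ij.2) ⟨by omega, by omega⟩]
  have key := hwalk.norm_integral_mul_sub_le hreg (hX.degree_ne_zero hne) hV.1 hsec hr hφ
    (fun _ => hG _) hf (fun _ => hF _)
  have e1 : ∀ x : X.carrier, φ (fun i => X.rowAt b N i x) =
      G (window x.1 (b + ((q : ℤ), 0)) (k + 1) (k + 1)) := fun x => by
    simp only [φ]
    congr 1; ext ij
    refine congrArg x.1 (Prod.ext ?_ ?_) <;> simp [add_assoc]
  have e2 : ∀ x : X.carrier, f (fun i => X.rowAt b N i x) =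
      F (window x.1 (b + ((p : ℤ), ((k + L : ℕ) : ℤ))) (k + 1) (k + 1)) := fun x => by
    simp only [f]
    congr 1; ext ij
    refine congrArg x.1 (Prod.ext ?_ ?_) <;> simp [add_assoc]
  simp only [e1, e2] at key
  refine le_trans (le_of_eq ?_) key
  simp only [mul_comm]

end Subshift

/-! ### Decay of correlations -/

namespace Subshift

variable {W : Type*} [TopologicalSpace W] {X : Subshift W} {d : ℕ}

theorem centralBox_shift (n : ℤ × ℤ) (x : X.carrier) (k : ℕ) :
    centralBox (X.shift n x).1 k = window x.1 (n + (-(k : ℤ), -(k : ℤ))) (2 * k + 1) (2 * k + 1) :=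
  window_shiftConfig _ _ _ _ _

variable [Finite W]

/-- For `λ = 0` the graphs have a bounded number of vertices; this forces `d = 1` and a single
symbol. -/
theorem subsingleton_of_isExpanderFamily_zero (hX : X.IsRegular d) (hne : X.carrier.Nonempty)
    {r : ℕ} (hH : IsExpanderFamily X.horizontalGraph d 0 r) : Subsingleton X.carrier := by
  have hd := hX.degree_ne_zero hne
  have hocc : ∀ m n, Nonempty (X.Pattern m n) := fun m n =>
    let ⟨x, hx⟩ := hne; ⟨⟨_, occurs_window hx 0 m n⟩⟩
  have hbound : ∀ N, 1 ≤ N → Nat.card (X.Pattern 1 1) * d ^ (N - 1) ≤ d ^ (r + 1) := by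
    intro N hN
    obtain ⟨hreg, hsec, hr⟩ := hH.2 N hN
    have := hocc 1 N
    have h := Digraph.card_le_of_secondEigenvalue_le_zero hreg hd hsec hr
    rw [← Nat.card_eq_fintype_card, hX.card_pattern hne le_rfl hN] at h
    simpa using h
  have hs : 1 ≤ Nat.card (X.Pattern 1 1) := have := hocc 1 1; Nat.card_pos
  have hd1 : d = 1 := by
    by_contra hcon
    have h1 : d ^ (r + 2) ≤ d ^ (r + 1) :=
      (Nat.le_mul_of_pos_left _ hs).trans (hbound (r + 3) (by omega))
    have h2 : d ^ (r + 1) < d ^ (r + 2) := Nat.pow_lt_pow_right (by omega) (by omega)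
    omega
  have hs1 : Nat.card (X.Pattern 1 1) ≤ 1 := by
    simpa [hd1] using hbound 1 le_rfl
  have hsub : Subsingleton (X.Pattern 1 1) := Finite.card_le_one_iff_subsingleton.1 hs1
  refine ⟨fun x y => Subtype.ext (funext fun b => ?_)⟩
  have := congrArg Subtype.val (hsub.elim ⟨_, occurs_window x.2 b 1 1⟩ ⟨_, occurs_window y.2 b 1 1⟩)
  simpa [window, Prod.mk_zero_zero] using congrFun this (0, 0)

variable [DiscreteTopology W]

theorem exists_bounded_centralBox_of_isLocallyConstant {f : X.carrier → ℂ}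
    (hf : IsLocallyConstant f) :
    ∃ B : ℝ, 0 ≤ B ∧ ∃ k₀, ∀ k, k₀ ≤ k → ∃ F : (Fin (2 * k + 1) × Fin (2 * k + 1) → W) → ℂ,
      (∀ p, ‖F p‖ ≤ B) ∧ ∀ x : X.carrier, f x = F (centralBox x.1 k) := by
  classical
  obtain ⟨C, hC⟩ := isCompact_univ.exists_bound_of_continuousOn hf.continuous.continuousOn
  obtain ⟨k₀, hk₀⟩ := exists_centralBox_of_isLocallyConstant hf
  refine ⟨max C 0, le_max_right _ _, k₀, fun k hk => ?_⟩
  refine ⟨fun p => if h : ∃ x : X.carrier, centralBox x.1 k = p then f h.choose else 0,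
    fun p => ?_, fun x => ?_⟩
  · dsimp only
    split_ifs with h
    · exact (hC _ (Set.mem_univ _)).trans (le_max_left _ _)
    · simp
  · have h : ∃ y : X.carrier, centralBox y.1 k = centralBox x.1 k := ⟨x, rfl⟩
    dsimp only
    rw [dif_pos h]
    exact hk₀ _ _ (centralBox_eq_of_le hk h.choose_spec.symm)

variable [MeasurableSpace W] [DiscreteMeasurableSpace W] {μ : Measure X.carrier}

theorem integral_comp_shift (hinv : ∀ a, MeasurePreserving (X.shift a) μ μ) {f : X.carrier → ℂ}
    (hf : Continuous f) (a : ℤ × ℤ) : ∫ x, f (X.shift a x) ∂μ = ∫ x, f x ∂μ := by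
  conv_rhs => rw [← (hinv a).map_eq]
  exact (integral_map (hinv a).measurable.aemeasurable hf.aestronglyMeasurable).symm

/-- Shift invariance exchanges the roles of `f` and `g`. -/
theorem correlation_neg (hinv : ∀ a, MeasurePreserving (X.shift a) μ μ) {f g : X.carrier → ℂ}
    (hf : Continuous f) (hg : Continuous g) (n : ℤ × ℤ) :
    X.correlation μ g f (-n) = X.correlation μ f g n := by
  have h := integral_comp_shift hinv
    (f := fun x => g (X.shift (-n) x) * f x) ((hg.comp (X.continuous_shift _)).mul hf) n
  have e : ∀ x, X.shift (-n) (X.shift n x) = x := fun x => by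
    apply Subtype.ext
    funext b
    simp [shift, shiftConfig]
  simp only [e] at h
  rw [correlation, correlation, ← h, mul_comm (∫ x, g x ∂μ)]
  simp only [mul_comm]

/-- If the longer component of `n` is nonnegative, both windows lie in one strip in the direction of
that component, which starts at the window of `g`. -/
theorem IsNaturalMeasure.norm_correlation_le_of_nonneg (hμ : X.IsNaturalMeasure d μ)
    (hX : X.IsRegular d) (hne : X.carrier.Nonempty) {lam : ℝ} {r : ℕ}
    (hH : IsExpanderFamily X.horizontalGraph d lam r)
    (hV : IsExpanderFamily X.verticalGraph d lam r) {f g : X.carrier → ℂ} (hf : Continuous f)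
    {B B' : ℝ} {k : ℕ}
    {F G : (Fin (2 * k + 1) × Fin (2 * k + 1) → W) → ℂ} (hF : ∀ p, ‖F p‖ ≤ B)
    (hG : ∀ p, ‖G p‖ ≤ B') (hfF : ∀ x : X.carrier, f x = F (centralBox x.1 k))
    (hgG : ∀ x : X.carrier, g x = G (centralBox x.1 k)) (n : ℤ × ℤ) (hk : 2 * k ≤ supNorm n)
    (hn : n.1 = supNorm n ∨ n.2 = supNorm n) :
    ‖X.correlation μ f g n‖ ≤ 2 * B' * B * (2 ^ r * max 1 ((supNorm n - 2 * k : ℕ) : ℝ) ^ (r - 1) *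
      lam ^ (supNorm n - 2 * k - (r - 1))) := by
  rw [correlation, ← integral_comp_shift hμ.measurePreserving_shift hf n]
  simp only [hfF, hgG, centralBox_shift]
  simp only [centralBox]
  have h1 : n.1.natAbs ≤ supNorm n := le_max_left _ _
  have h2 : n.2.natAbs ≤ supNorm n := le_max_right _ _
  rcases hn with hn | hn
  · have key := hμ.norm_integral_mul_sub_le_right hX hne hH hF hG
      (-(k : ℤ), -(k : ℤ) + min 0 n.2) (n.2 - min 0 n.2).toNat (-min 0 n.2).toNat
      (supNorm n - 2 * k)
    have e1 : ((-(k : ℤ), -(k : ℤ) + min 0 n.2) : ℤ × ℤ) + (0, ((-min 0 n.2).toNat : ℤ)) =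
        (-(k : ℤ), -(k : ℤ)) := by ext <;> simp
    have e2 : ((-(k : ℤ), -(k : ℤ) + min 0 n.2) : ℤ × ℤ) +
        (((2 * k + (supNorm n - 2 * k) : ℕ) : ℤ), ((n.2 - min 0 n.2).toNat : ℤ)) =
        n + (-(k : ℤ), -(k : ℤ)) := by
      ext <;> simp only [Prod.fst_add, Prod.snd_add] <;> omega
    rwa [e1, e2] at key
  · have key := hμ.norm_integral_mul_sub_le_up hX hne hV hF hG
      (-(k : ℤ) + min 0 n.1, -(k : ℤ)) (n.1 - min 0 n.1).toNat (-min 0 n.1).toNat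
      (supNorm n - 2 * k)
    have e1 : ((-(k : ℤ) + min 0 n.1, -(k : ℤ)) : ℤ × ℤ) + (((-min 0 n.1).toNat : ℤ), 0) =
        (-(k : ℤ), -(k : ℤ)) := by ext <;> simp
    have e2 : ((-(k : ℤ) + min 0 n.1, -(k : ℤ)) : ℤ × ℤ) +
        (((n.1 - min 0 n.1).toNat : ℤ), ((2 * k + (supNorm n - 2 * k) : ℕ) : ℤ)) =
        n + (-(k : ℤ), -(k : ℤ)) := by
      ext <;> simp only [Prod.fst_add, Prod.snd_add] <;> omega
    rwa [e1, e2] at key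

theorem supNorm_neg (n : ℤ × ℤ) : supNorm (-n) = supNorm n := by
  simp [supNorm]

theorem IsNaturalMeasure.exists_norm_correlation_le (hμ : X.IsNaturalMeasure d μ)
    (hX : X.IsRegular d) (hne : X.carrier.Nonempty) {lam : ℝ} {r : ℕ}
    (hH : IsExpanderFamily X.horizontalGraph d lam r)
    (hV : IsExpanderFamily X.verticalGraph d lam r) {f g : X.carrier → ℂ}
    (hf : IsLocallyConstant f) (hg : IsLocallyConstant g) :
    ∃ D : ℝ, 0 ≤ D ∧ ∃ k : ℕ, ∀ n, 2 * k ≤ supNorm n → ‖X.correlation μ f g n‖ ≤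
      D * (max 1 ((supNorm n - 2 * k : ℕ) : ℝ) ^ (r - 1) *
        lam ^ (supNorm n - 2 * k - (r - 1))) := by
  obtain ⟨B, hB, k₁, h₁⟩ := exists_bounded_centralBox_of_isLocallyConstant hf
  obtain ⟨B', hB', k₂, h₂⟩ := exists_bounded_centralBox_of_isLocallyConstant hg
  obtain ⟨F, hF, hfF⟩ := h₁ (max k₁ k₂) (le_max_left _ _)
  obtain ⟨G, hG, hgG⟩ := h₂ (max k₁ k₂) (le_max_right _ _)
  refine ⟨2 * B * B' * 2 ^ r, by positivity, max k₁ k₂, fun n hn => ?_⟩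
  have hcases : (n.1 = supNorm n ∨ n.2 = supNorm n) ∨
      ((-n).1 = supNorm (-n) ∨ (-n).2 = supNorm (-n)) := by
    rw [supNorm_neg]
    simp only [supNorm, Prod.fst_neg, Prod.snd_neg]
    omega
  rcases hcases with h | h
  · refine (hμ.norm_correlation_le_of_nonneg hX hne hH hV hf.continuous hF hG hfF hgG n hn h).trans
      (le_of_eq ?_)
    ring
  · rw [← correlation_neg hμ.measurePreserving_shift hf.continuous hg.continuous]
    have := hμ.norm_correlation_le_of_nonneg hX hne hH hV hg.continuous hG hF hgG hfF (-n)
      (by rwa [supNorm_neg]) h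
    rw [supNorm_neg] at this
    refine this.trans (le_of_eq ?_)
    ring

theorem IsNaturalMeasure.exists_decay (hμ : X.IsNaturalMeasure d μ)
    (hX : X.IsRegular d) (hne : X.carrier.Nonempty) {lam : ℝ} {r : ℕ}
    (hH : IsExpanderFamily X.horizontalGraph d lam r)
    (hV : IsExpanderFamily X.verticalGraph d lam r) {f g : X.carrier → ℂ}
    (hf : IsLocallyConstant f) (hg : IsLocallyConstant g) :
    ∃ C : ℝ, 0 < C ∧ ∀ n : ℤ × ℤ, ‖X.correlation μ f g n‖ ≤
      C * (max 1 (supNorm n) : ℝ) ^ (r - 1) * lam ^ supNorm n := by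
  have := hμ.isProbabilityMeasure
  have hlam0 : 0 ≤ lam := (div_nonneg Digraph.secondEigenvalue_nonneg (Nat.cast_nonneg d)).trans
    (hH.2 1 le_rfl).2.1
  rcases hlam0.eq_or_lt with rfl | hpos
  · have hsub := subsingleton_of_isExpanderFamily_zero hX hne hH
    refine ⟨1, one_pos, fun n => ?_⟩
    obtain ⟨x, hx⟩ := hne
    have hc : ∀ h : X.carrier → ℂ, h = fun _ => h ⟨x, hx⟩ := fun h =>
      funext fun y => congrArg h (Subsingleton.elim _ _)
    rw [correlation, hc f, hc g]
    simp only [integral_const, probReal_univ, one_smul, sub_self, norm_zero]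
    positivity
  obtain ⟨D, hD, k, hk⟩ := hμ.exists_norm_correlation_le hX hne hH hV hf hg
  have hmem : ∀ {f : X.carrier → ℂ}, IsLocallyConstant f → MemLp f 2 μ := fun {f} hf => by
    obtain ⟨C, hC⟩ := isCompact_univ.exists_bound_of_continuousOn hf.continuous.continuousOn
    exact MemLp.of_bound hf.continuous.aestronglyMeasurable C
      (Eventually.of_forall fun x => hC x (Set.mem_univ x))
  set E : ℝ := 2 * (eLpNorm f 2 μ).toReal * (eLpNorm g 2 μ).toReal with hE
  have hE0 : 0 ≤ E := by positivity
  have htriv : ∀ n, ‖X.correlation μ f g n‖ ≤ E :=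
    norm_correlation_le hμ.measurePreserving_shift (hmem hf) (hmem hg)
  -- The loss `λ ^ (-(2 k + r))` absorbs the width of the windows and the size of the blocks.
  refine ⟨(D + E + 1) * (lam ^ (2 * k + r))⁻¹, by positivity, fun n => ?_⟩
  set t := supNorm n with ht
  have hp : 0 < lam ^ (2 * k + r) := by positivity
  have hone : (1 : ℝ) ≤ max 1 (t : ℝ) ^ (r - 1) := one_le_pow₀ (le_max_left _ _)
  rcases le_total (2 * k) t with h | h
  · have h1 : lam ^ (t - 2 * k - (r - 1)) ≤ (lam ^ (2 * k + r))⁻¹ * lam ^ t := by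
      rw [le_inv_mul_iff₀ hp, ← pow_add]
      exact pow_le_pow_of_le_one hlam0 hH.1.le (by omega)
    calc ‖X.correlation μ f g n‖ ≤ D * (max 1 ((t - 2 * k : ℕ) : ℝ) ^ (r - 1) *
          lam ^ (t - 2 * k - (r - 1))) := hk n h
      _ ≤ (D + E + 1) * (max 1 (t : ℝ) ^ (r - 1) * ((lam ^ (2 * k + r))⁻¹ * lam ^ t)) := by
          gcongr
          · linarith
          · omega
      _ = _ := by ring
  · have h1 : 1 ≤ (lam ^ (2 * k + r))⁻¹ * lam ^ t := by
      rw [le_inv_mul_iff₀ hp, mul_one]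
      exact pow_le_pow_of_le_one hlam0 hH.1.le (by omega)
    calc ‖X.correlation μ f g n‖ ≤ E * 1 * 1 := by simpa using htriv n
      _ ≤ (D + E + 1) * max 1 (t : ℝ) ^ (r - 1) * ((lam ^ (2 * k + r))⁻¹ * lam ^ t) := by
          gcongr
          linarith
      _ = _ := by ring

end Subshift

theorem tendsto_const_mul_max_pow_mul_pow {lam : ℝ} (h0 : 0 ≤ lam) (h1 : lam < 1) (C : ℝ) (m : ℕ) :
    Tendsto (fun t : ℕ => C * (max 1 (t : ℝ)) ^ m * lam ^ t) atTop (𝓝 0) := by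
  have h := (tendsto_pow_const_mul_const_pow_of_lt_one m h0 h1).const_mul C
  rw [mul_zero] at h
  refine h.congr' ?_
  filter_upwards [eventually_ge_atTop 1] with t ht
  rw [max_eq_right (by exact_mod_cast ht), mul_assoc]

end

theorem mainTheorem3 {W : Type*} [Finite W] [TopologicalSpace W] [DiscreteTopology W]
    [MeasurableSpace W] [DiscreteMeasurableSpace W]
    (X : Subshift W) (hne : X.carrier.Nonempty) (d : ℕ)
    (hreg : X.IsRegular d) (hext : X.IsExtendable)
    (lam : ℝ) (r : ℕ)
    (hH : IsExpanderFamily X.horizontalGraph d lam r)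
    (hV : IsExpanderFamily X.verticalGraph d lam r) :
    (∃! μ : Measure X.carrier, X.IsNaturalMeasure d μ) ∧
    ∀ μ : Measure X.carrier, X.IsNaturalMeasure d μ →
      X.IsStronglyMixing μ ∧
      ∀ f g : X.carrier → ℂ, IsLocallyConstant f → IsLocallyConstant g →
        ∃ C : ℝ, 0 < C ∧ ∀ n : ℤ × ℤ,
          ‖(∫ x, f (X.shift n x) * g x ∂μ) - (∫ x, f x ∂μ) * ∫ x, g x ∂μ‖ ≤
            C * (max 1 (supNorm n) : ℝ) ^ (r - 1) * lam ^ supNorm n := by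
  obtain ⟨μ₀, hμ₀⟩ := hreg.exists_isNaturalMeasure hne
  refine ⟨⟨μ₀, hμ₀, fun ν hν => Subshift.IsNaturalMeasure.eq hν hμ₀⟩, fun μ hμ => ?_⟩
  have := hμ.isProbabilityMeasure
  refine ⟨Subshift.isStronglyMixing_of_isLocallyConstant hμ.measurePreserving_shift ?_,
    fun f g hf hg => hμ.exists_decay hreg hne hH hV hf hg⟩
  intro f g hf hg
  obtain ⟨C, -, hC⟩ := hμ.exists_decay hreg hne hH hV hf hg
  have hlam0 : 0 ≤ lam := (div_nonneg Digraph.secondEigenvalue_nonneg (Nat.cast_nonneg d)).trans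
    (hH.2 1 le_rfl).2.1
  exact squeeze_zero_norm hC
    ((tendsto_const_mul_max_pow_mul_pow hlam0 hH.1 C (r - 1)).comp tendsto_comap)
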